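/- Let $\Bbbk$ be a field of characteristic zero. Let $\mathsf{CoCom}$ denote the category of counital cocommutative $\Bbbk$-coalgebras $C$ that are conilpotent (so $C$ has a canonical coaugmentation $\Bbbk\to C$, given by the unique group-like element $1\in C$) and of finite type, meaning that the space of primitives $\mathrm{Prim}(C)=\{x : \Delta x=x\otimes 1+1\otimes x\}$ is finite-dimensional; morphisms are all counital coalgebra morphisms. For such $C$ the linear dual $\Bbbk[C]=C^\vee$ is a commutative local algebra whose maximal ideal $\mathfrak m_C$ consists of the functionals vanishing at $1$. A morphism $f\colon C\to D$ is a formal submersion if $f^\vee\colon \Bbbk[D]\to\Bbbk[C]$ is formally smooth for the $\mathfrak m_D$-adic and $\mathfrak m_C$-adic topologies: for every discrete commutative ring $A$ and ideal $N\subseteq A$ with $N^2=0$, every commutative square of continuous ring homomorphisms from $f^\vee$ to $A\to A/N$ has a continuous diagonal filler $\Bbbk[C]\to A$. A coalgebra $C$ is a pointed formal manifold if its counit $C\to\Bbbk$ is a formal submersion. For a finite-dimensional vector space $V$, let $\mathrm{Sym}^{\mathrm{co}}(V)$ be the symmetric coalgebra: the symmetric algebra of $V$ with the multiplicative comultiplication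 for which the elements of $V$ are primitive. 1. The category $\mathsf{CoCom}$ with the class $\mathcal S_{fs}$ of formal submersions is a descent category. That is, $\mathcal S_{fs}$ is a subcategory (it contains all identities and is closed under composition), and: (i) $\mathsf{CoCom}$ has all finite limits; (ii) the unique map from the terminal object to itself is in $\mathcal S_{fs}$; (iii) $\mathcal S_{fs}$ is closed under base change along arbitrary morphisms; (iv) if $f$ and $g\circ f$ are in $\mathcal S_{fs}$, then so is $g$; (v) every morphism in $\mathcal S_{fs}$ is an effective epimorphism, i.e. has a kernel pair and is the coequalizer of it. 2. If $f\colon C\to D$ is a formal submersion, then $\mathrm{Prim}(f)\colon\mathrm{Prim}(C)\to\mathrm{Prim}(D)$ is surjective. 3. A coalgebra $C\in\mathsf{CoCom}$ is a pointed formal manifold if and only if there is a finite-dimensional vector space $V$ with $C\cong\mathrm{Sym}^{\mathrm{co}}(V)$. Here $\mathrm{Sym}^{\mathrm{co}}(V)$ is the cofree conilpotent cocommutative coalgebra cogenerated by $V$: for every conilpotent cocommutative coalgebra $D$, each linear map $\varphi\colon D\to V$ with $\varphi(1)=0$ lifts along the projection $\mathrm{Sym}^{\mathrm{co}}(V)\to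 V$ to a unique coalgebra morphism $D\to\mathrm{Sym}^{\mathrm{co}}(V)$. 4. If $f\colon C\to D$ is a morphism between pointed formal manifolds and $\mathrm{Prim}(f)$ is surjective, then $f$ is a formal submersion. -/

import Mathlib

open CategoryTheory CategoryTheory.Limits
open scoped TensorProduct

universe u

noncomputable section

namespace FormalCoalg

/-! ### Conilpotent coalgebras and primitive elements -/

section Basic

variable {k C D : Type u} [Field k]
  [AddCommGroup C] [Module k C] [Coalgebra k C] [AddCommGroup D] [Module k D] [Coalgebra k D]

/-- The reduced comultiplication `x ↦ Δ x - x ⊗ e - e ⊗ x` of a coalgebra with base point `e`. -/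
def reducedComul (k : Type u) [Field k] [Module k C] [Coalgebra k C] (e : C) : C →ₗ[k] C ⊗[k] C :=
  Coalgebra.comul - (TensorProduct.mk k C C).flip e - TensorProduct.mk k C C e

/-- The primitive elements `{x | Δ x = x ⊗ e + e ⊗ x}`. -/
def primitives (k : Type u) [Field k] [Module k C] [Coalgebra k C] (e : C) : Submodule k C :=
  LinearMap.ker (reducedComul k e)

/-- The primitive filtration: `F₀ = k e` and
`Fₙ₊₁ = {x | Δ x - x ⊗ e - e ⊗ x ∈ Fₙ ⊗ Fₙ}`. -/
def primFiltration (k : Type u) [Field k] [Module k C] [Coalgebra k C] (e : C) :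
    ℕ → Submodule k C
  | 0 => Submodule.span k {e}
  | n + 1 => Submodule.comap (reducedComul k e)
      (LinearMap.range (TensorProduct.map (primFiltration k e n).subtype
        (primFiltration k e n).subtype))

/-- `C` is conilpotent (connected) with coaugmentation `k → C`, `1 ↦ e`: the element `e` is
group-like and the primitive filtration is exhaustive. -/
structure IsConilpotent (k : Type u) [Field k] [Module k C] [Coalgebra k C] (e : C) : Prop where
  isGroupLike : IsGroupLikeElem k e
  exhaustive : ∀ x : C, ∃ n, x ∈ primFiltration k e n

theorem reducedComul_apply (e x : C) :
    reducedComul k e x = Coalgebra.comul (R := k) x - x ⊗ₜ[k] e - e ⊗ₜ[k] x := by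
  simp [reducedComul]

theorem mem_primitives {e x : C} :
    x ∈ primitives k e ↔ Coalgebra.comul (R := k) x = x ⊗ₜ[k] e + e ⊗ₜ[k] x := by
  rw [primitives, LinearMap.mem_ker, reducedComul_apply, sub_sub, sub_eq_zero]

theorem mem_of_tmul_self_mem {C : Type u} [AddCommGroup C] [Module k C] (F : Submodule k C) (x : C)
    (h : x ⊗ₜ[k] x ∈ LinearMap.range (TensorProduct.map F.subtype F.subtype)) : x ∈ F := by
  by_contra hx
  obtain ⟨f, hf, hF⟩ := Submodule.exists_le_ker_of_notMem hx
  obtain ⟨t, ht⟩ := h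
  have h0 : (TensorProduct.map f f) ∘ₗ (TensorProduct.map F.subtype F.subtype) = 0 := by
    rw [← TensorProduct.map_comp]
    have : f ∘ₗ F.subtype = 0 := by
      ext y; exact hF y.2
    rw [this, TensorProduct.map_zero_left]
  have h1 : TensorProduct.map f f (x ⊗ₜ[k] x) = 0 := by
    rw [← ht, ← LinearMap.comp_apply, h0]; rfl
  rw [TensorProduct.map_tmul] at h1
  have h2 := congrArg (TensorProduct.lid k k) h1
  simp at h2
  exact hf h2

/-- A conilpotent coalgebra has only one group-like element. -/
theorem IsConilpotent.eq_of_isGroupLike {e g : C} (he : IsConilpotent k e)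
    (hg : IsGroupLikeElem k g) : g = e := by
  have hred : reducedComul k e (g - e) = (g - e) ⊗ₜ[k] (g - e) := by
    rw [reducedComul_apply, map_sub, hg.comul_eq_tmul_self, he.isGroupLike.comul_eq_tmul_self]
    simp only [TensorProduct.sub_tmul, TensorProduct.tmul_sub]
    abel
  have key : ∀ n, g - e ∈ primFiltration k e n → g - e = 0 := by
    intro n
    induction n with
    | zero =>
      intro h
      obtain ⟨c, hc⟩ := Submodule.mem_span_singleton.1 h
      have h1 := congrArg (Coalgebra.counit (R := k)) hc
      rw [map_smul, map_sub, hg.counit_eq_one, he.isGroupLike.counit_eq_one] at h1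
      simp at h1
      rw [← hc, h1, zero_smul]
    | succ n ih =>
      intro h
      refine ih (mem_of_tmul_self_mem _ _ ?_)
      rw [← hred]
      exact h
  obtain ⟨n, hn⟩ := he.exhaustive (g - e)
  exact sub_eq_zero.1 (key n hn)

end Basic

/-! ### The category of finite-type conilpotent cocommutative coalgebras -/

/-- Finite-type conilpotent counital cocommutative coalgebras over `k`. The point `pt` is the
image of `1` under the coaugmentation; it is the unique group-like element. -/
structure CoCom (k : Type u) [Field k] : Type (u + 1) where
  carrier : Type u
  [addCommGroup : AddCommGroup carrier]
  [module : Module k carrier]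
  [coalgebra : Coalgebra k carrier]
  [isCocomm : Coalgebra.IsCocomm k carrier]
  pt : carrier
  isConilpotent : IsConilpotent k pt
  finiteType : Module.Finite k (primitives k pt)

attribute [instance] CoCom.addCommGroup CoCom.module CoCom.coalgebra CoCom.isCocomm

variable {k : Type u} [Field k]

/-- Morphisms are all (counital) coalgebra morphisms. -/
@[ext]
structure CoCom.Hom (C D : CoCom k) : Type u where
  hom : C.carrier →ₗc[k] D.carrier

instance : Category (CoCom k) where
  Hom C D := CoCom.Hom C D
  id C := ⟨CoalgHom.id k C.carrier⟩
  comp f g := ⟨g.hom.comp f.hom⟩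

theorem CoCom.Hom.map_pt {C D : CoCom k} (f : C ⟶ D) : f.hom C.pt = D.pt :=
  D.isConilpotent.eq_of_isGroupLike (C.isConilpotent.isGroupLike.map f.hom)

/-- The space `Prim(C)` of primitive elements. -/
abbrev Prim (C : CoCom k) : Submodule k C.carrier := primitives k C.pt

/-- The linear map `Prim(f) : Prim(C) → Prim(D)`. -/
def Prim.map {C D : CoCom k} (f : C ⟶ D) : Prim C →ₗ[k] Prim D :=
  (f.hom : C.carrier →ₗ[k] D.carrier).restrict (fun x hx => by
    rw [mem_primitives] at hx ⊢
    have h := CoalgHomClass.map_comp_comul_apply f.hom x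
    rw [hx] at h
    simpa [CoCom.Hom.map_pt] using h.symm)

/-! ### The dual algebra and formal submersions -/

/-- The algebra of functions `k[C] = C^∨`: the full linear dual with the convolution product. -/
abbrev FunAlg (C : CoCom k) : Type u := WithConv (C.carrier →ₗ[k] k)

/-- The maximal ideal of `k[C]`: the functions vanishing at the base point, i.e. the kernel of the
augmentation dual to the coaugmentation. -/
def FunAlg.maxIdeal (C : CoCom k) : Ideal (FunAlg C) where
  carrier := {f | f.ofConv C.pt = 0}
  add_mem' {f g} hf hg := by
    simp only [Set.mem_ofPred_eq] at hf hg ⊢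
    simp [hf, hg]
  zero_mem' := by simp
  smul_mem' f g hg := by
    simp only [Set.mem_ofPred_eq] at hg ⊢
    simp [LinearMap.convMul_def, C.isConilpotent.isGroupLike.comul_eq_tmul_self, hg]

/-- The algebra morphism `f^∨ : k[D] → k[C]`, precomposition with `f`. -/
def FunAlg.map {C D : CoCom k} (f : C ⟶ D) : FunAlg D →+* FunAlg C where
  toFun φ := WithConv.toConv (φ.ofConv ∘ₗ (f.hom : C.carrier →ₗ[k] D.carrier))
  map_one' := by
    ext x
    simp [LinearMap.convOne_def]
  map_mul' φ ψ := by
    exact congrArg WithConv.toConv (LinearMap.convMul_comp_coalgHom_distrib φ ψ f.hom)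
  map_zero' := by ext x; simp
  map_add' φ ψ := by ext x; simp

/-- Formal smoothness of a homomorphism `φ : R → S` of topological rings carrying the `I`-adic and
the `J`-adic topology: for every discrete ring `A` and square-zero ideal `N` of `A`, every
commutative square of continuous ring homomorphisms from `φ` to `A → A / N` has a continuous
diagonal filler. A homomorphism to a discrete ring is continuous iff it kills a power of the
ideal that defines the topology. -/
def IsFormallySmoothAdic {R S : Type u} [CommRing R] [CommRing S] (I : Ideal R) (J : Ideal S)
    (φ : R →+* S) : Prop :=
  ∀ (A : Type u) [CommRing A] (N : Ideal A), N ^ 2 = ⊥ →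
    ∀ (α : R →+* A) (β : S →+* A ⧸ N),
      (∃ n : ℕ, I ^ n ≤ RingHom.ker α) → (∃ n : ℕ, J ^ n ≤ RingHom.ker β) →
      (Ideal.Quotient.mk N).comp α = β.comp φ →
      ∃ γ : S →+* A, (∃ n : ℕ, J ^ n ≤ RingHom.ker γ) ∧
        γ.comp φ = α ∧ (Ideal.Quotient.mk N).comp γ = β

/-- `f : C → D` is a formal submersion if `f^∨ : k[D] → k[C]` is formally smooth for the
topologies defined by the maximal ideals. -/
def IsFormalSubmersion {C D : CoCom k} (f : C ⟶ D) : Prop :=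
  IsFormallySmoothAdic (FunAlg.maxIdeal D) (FunAlg.maxIdeal C) (FunAlg.map f)

/-- The class of formal submersions. -/
def formalSubmersions (k : Type u) [Field k] : MorphismProperty (CoCom k) :=
  fun _ _ f => IsFormalSubmersion f

/-- The ground field as an object. -/
def CoCom.ground (k : Type u) [Field k] : CoCom k where
  carrier := k
  pt := 1
  isConilpotent :=
    { isGroupLike := isGroupLikeElem_self.2 rfl
      exhaustive := fun x => ⟨0, Submodule.mem_span_singleton.2 ⟨x, by simp⟩⟩ }
  finiteType := inferInstance

/-- The counit `C → k` as a morphism. -/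
def CoCom.counit (C : CoCom k) : C ⟶ CoCom.ground k :=
  CoCom.Hom.mk (C := C) (D := CoCom.ground k) (Coalgebra.counitCoalgHom k C.carrier)

/-- `C` is a pointed formal manifold if its counit is a formal submersion. -/
def IsFormalManifold (C : CoCom k) : Prop := IsFormalSubmersion C.counit

/-! ### Descent categories -/

/-- A morphism is an effective epimorphism if it has a kernel pair and is its coequalizer. -/
def IsEffectiveEpimorphism {𝒟 : Type*} [Category 𝒟] {X Y : 𝒟} (f : X ⟶ Y) : Prop :=
  ∃ (R : 𝒟) (p q : R ⟶ X) (h : IsKernelPair f p q), Nonempty (IsColimit (Cofork.ofπ f h.w))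

/-- A (subcanonical) descent category: a category with a subcategory `S` of covers. -/
structure IsDescentCategory (𝒟 : Type*) [Category 𝒟] (S : MorphismProperty 𝒟) : Prop where
  /-- the covers form a subcategory -/
  isMultiplicative : S.IsMultiplicative
  hasFiniteLimits : HasFiniteLimits 𝒟
  terminal : ∀ (T : 𝒟), IsTerminal T → S (𝟙 T)
  baseChange : S.IsStableUnderBaseChange
  cancel : ∀ {X Y Z : 𝒟} (f : X ⟶ Y) (g : Y ⟶ Z), S f → S (f ≫ g) → S g
  effective : ∀ {X Y : 𝒟} (f : X ⟶ Y), S f → IsEffectiveEpimorphism f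

/-! ### The symmetric coalgebra -/

section Sym

variable (k) (V : Type u) [AddCommGroup V] [Module k V]

/-- The projection `Sym(V) → V` onto the summand of degree one. -/
def symProj : SymmetricAlgebra k V →ₗ[k] V := by
  letI : Module kᵐᵒᵖ V := Module.compHom _ ((RingHom.id k).fromOpposite mul_comm)
  haveI : IsCentralScalar k V := ⟨fun r m => rfl⟩
  exact (TrivSqZeroExt.sndHom k V).comp
    (SymmetricAlgebra.lift (TrivSqZeroExt.inrHom k V)).toLinearMap

theorem symProj_ι (v : V) : symProj k V (SymmetricAlgebra.ι k V v) = v := by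
  simp [symProj]

theorem symProj_one : symProj k V 1 = 0 := by
  let : Module kᵐᵒᵖ V := Module.compHom _ ((RingHom.id k).fromOpposite mul_comm)
  have : IsCentralScalar k V := ⟨fun r m => rfl⟩
  exact congrArg TrivSqZeroExt.snd
    (map_one (SymmetricAlgebra.lift (TrivSqZeroExt.inrHom k V)))

variable {V}

theorem tmul_mem_range_map {M : Type u} [AddCommGroup M] [Module k M] (F : Submodule k M) {a b : M}
    (ha : a ∈ F) (hb : b ∈ F) :
    a ⊗ₜ[k] b ∈ LinearMap.range (TensorProduct.map F.subtype F.subtype) :=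
  ⟨⟨a, ha⟩ ⊗ₜ ⟨b, hb⟩, by simp⟩

theorem range_map_le {M : Type u} [AddCommGroup M] [Module k M] (F : Submodule k M)
    (P : Submodule k (M ⊗[k] M)) (h : ∀ a ∈ F, ∀ b ∈ F, a ⊗ₜ[k] b ∈ P) :
    LinearMap.range (TensorProduct.map F.subtype F.subtype) ≤ P := by
  rintro _ ⟨t, rfl⟩
  induction t with
  | zero => simp
  | add x y hx hy => rw [map_add]; exact P.add_mem hx hy
  | tmul a b => rw [TensorProduct.map_tmul]; exact h _ a.2 _ b.2

variable (V)

/-- The elements of the symmetric algebra of degree at most `n`. -/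
def symFil (n : ℕ) : Submodule k (SymmetricAlgebra k V) :=
  (1 ⊔ LinearMap.range (SymmetricAlgebra.ι k V)) ^ n

theorem symFil_mono {m n : ℕ} (h : m ≤ n) : symFil k V m ≤ symFil k V n :=
  pow_le_pow_right' le_sup_left h

theorem ι_mem_symFil (v : V) : SymmetricAlgebra.ι k V v ∈ symFil k V 1 := by
  rw [symFil, pow_one]
  exact Submodule.mem_sup_right ⟨v, rfl⟩

theorem symFil_mul_mem {n : ℕ} {a : SymmetricAlgebra k V} (ha : a ∈ symFil k V n) (v : V) :
    a * SymmetricAlgebra.ι k V v ∈ symFil k V (n + 1) := by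
  have := ι_mem_symFil k V v
  rw [symFil, pow_one] at this
  rw [symFil, pow_succ]
  exact Submodule.mul_mem_mul ha this

theorem reducedComul_mul_ι (x : SymmetricAlgebra k V) (v : V) :
    reducedComul k 1 (x * SymmetricAlgebra.ι k V v) =
      x ⊗ₜ[k] SymmetricAlgebra.ι k V v + SymmetricAlgebra.ι k V v ⊗ₜ[k] x +
      (reducedComul k 1 x * (SymmetricAlgebra.ι k V v ⊗ₜ[k] 1) +
        reducedComul k 1 x * (1 ⊗ₜ[k] SymmetricAlgebra.ι k V v)) := by
  simp only [reducedComul_apply, Bialgebra.comul_mul, SymmetricAlgebra.comul_ι, mul_add, sub_mul,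
    Algebra.TensorProduct.tmul_mul_tmul, mul_one, one_mul]
  abel

theorem reducedComul_mem (n : ℕ) (x : SymmetricAlgebra k V) (hx : x ∈ symFil k V (n + 1)) :
    reducedComul k 1 x ∈
      LinearMap.range (TensorProduct.map (symFil k V n).subtype (symFil k V n).subtype) := by
  have one_mem : ∀ n, (1 : SymmetricAlgebra k V) ∈ symFil k V n := fun n =>
    symFil_mono k V (Nat.zero_le n) (by rw [symFil, pow_zero]; exact Submodule.one_le.1 le_rfl)
  have mono : ∀ n, LinearMap.range
        (TensorProduct.map (symFil k V n).subtype (symFil k V n).subtype) ≤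
      LinearMap.range
        (TensorProduct.map (symFil k V (n + 1)).subtype (symFil k V (n + 1)).subtype) :=
    fun n => range_map_le k _ _ fun a ha b hb =>
      tmul_mem_range_map k _ (symFil_mono k V n.le_succ ha) (symFil_mono k V n.le_succ hb)
  induction n generalizing x with
  | zero =>
    rw [symFil, zero_add, pow_one] at hx
    obtain ⟨y, hy, z, ⟨v, rfl⟩, rfl⟩ := Submodule.mem_sup.1 hx
    obtain ⟨c, rfl⟩ := Submodule.mem_one.1 hy
    rw [map_add]
    refine Submodule.add_mem _ ?_ ?_
    · rw [Algebra.algebraMap_eq_smul_one, map_smul, reducedComul_apply, Bialgebra.comul_one,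
        Algebra.TensorProduct.one_def, sub_self, zero_sub]
      exact Submodule.smul_mem _ _
        (Submodule.neg_mem _ (tmul_mem_range_map k _ (one_mem 0) (one_mem 0)))
    · rw [reducedComul_apply, SymmetricAlgebra.comul_ι, sub_sub, sub_self]
      exact Submodule.zero_mem _
  | succ n ih =>
    rw [symFil, pow_succ] at hx
    refine Submodule.mul_induction_on hx ?_ ?_
    · intro a ha y hy
      obtain ⟨y, hy', z, ⟨v, rfl⟩, rfl⟩ := Submodule.mem_sup.1 hy
      obtain ⟨c, rfl⟩ := Submodule.mem_one.1 hy'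
      have hr := ih a ha
      rw [mul_add, map_add]
      refine Submodule.add_mem _ ?_ ?_
      · rw [mul_comm, ← Algebra.smul_def, map_smul]
        exact Submodule.smul_mem _ _ (mono n hr)
      · rw [reducedComul_mul_ι]
        have hv : SymmetricAlgebra.ι k V v ∈ symFil k V (n + 1) :=
          symFil_mono k V (Nat.succ_le_succ n.zero_le) (ι_mem_symFil k V v)
        refine Submodule.add_mem _ (Submodule.add_mem _ (tmul_mem_range_map k _ ha hv)
          (tmul_mem_range_map k _ hv ha)) (Submodule.add_mem _ ?_ ?_)
        · refine range_map_le k _ (Submodule.comap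
            (LinearMap.mulRight k (SymmetricAlgebra.ι k V v ⊗ₜ[k] 1))
            (LinearMap.range (TensorProduct.map _ _))) ?_ hr
          intro b hb c hc
          rw [Submodule.mem_comap, LinearMap.mulRight_apply,
            Algebra.TensorProduct.tmul_mul_tmul, mul_one]
          exact tmul_mem_range_map k _ (symFil_mul_mem k V hb v) (symFil_mono k V n.le_succ hc)
        · refine range_map_le k _ (Submodule.comap
            (LinearMap.mulRight k (1 ⊗ₜ[k] SymmetricAlgebra.ι k V v))
            (LinearMap.range (TensorProduct.map _ _))) ?_ hr
          intro b hb c hc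
          rw [Submodule.mem_comap, LinearMap.mulRight_apply,
            Algebra.TensorProduct.tmul_mul_tmul, mul_one]
          exact tmul_mem_range_map k _ (symFil_mono k V n.le_succ hb) (symFil_mul_mem k V hc v)
    · intro a b ha hb
      rw [map_add]
      exact Submodule.add_mem _ ha hb

theorem symFil_le (n : ℕ) :
    symFil k V n ≤ primFiltration k (1 : SymmetricAlgebra k V) n := by
  induction n with
  | zero => rw [symFil, pow_zero, primFiltration, Submodule.one_eq_span]
  | succ n ih =>
    intro x hx
    exact range_map_le k _ _ (fun a ha b hb => tmul_mem_range_map k _ (ih ha) (ih hb))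
      (reducedComul_mem k V n x hx)

theorem exists_mem_symFil (x : SymmetricAlgebra k V) : ∃ n, x ∈ symFil k V n := by
  induction x using SymmetricAlgebra.induction with
  | algebraMap r => exact ⟨0, by rw [symFil, pow_zero]; exact Submodule.mem_one.2 ⟨r, rfl⟩⟩
  | ι v => exact ⟨1, ι_mem_symFil k V v⟩
  | mul a b ha hb =>
    obtain ⟨m, hm⟩ := ha
    obtain ⟨n, hn⟩ := hb
    exact ⟨m + n, by rw [symFil, pow_add]; exact Submodule.mul_mem_mul hm hn⟩
  | add a b ha hb =>
    obtain ⟨m, hm⟩ := ha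
    obtain ⟨n, hn⟩ := hb
    exact ⟨max m n, Submodule.add_mem _ (symFil_mono k V (le_max_left _ _) hm)
      (symFil_mono k V (le_max_right _ _) hn)⟩

theorem isConilpotent_sym : IsConilpotent k (1 : SymmetricAlgebra k V) where
  isGroupLike := ⟨Bialgebra.counit_one, by
    rw [Bialgebra.comul_one, Algebra.TensorProduct.one_def]⟩
  exhaustive x := by
    obtain ⟨n, hn⟩ := exists_mem_symFil k V x
    exact ⟨n, symFil_le k V n hn⟩

theorem primitives_sym_le [CharZero k] :
    primitives k (1 : SymmetricAlgebra k V) ≤ LinearMap.range (SymmetricAlgebra.ι k V) := by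
  intro x hx
  let L := LinearMap.range (SymmetricAlgebra.ι k V)
  let Ψ : SymmetricAlgebra k V →ₐ[k] SymmetricAlgebra k V :=
    (Algebra.TensorProduct.lmul' k).comp (Bialgebra.comulAlgHom k (SymmetricAlgebra k V))
  let E : ℕ → Submodule k (SymmetricAlgebra k V) := fun n =>
    Module.End.eigenspace Ψ.toLinearMap ((2 : k) ^ n)
  have hΨ : ∀ v, Ψ (SymmetricAlgebra.ι k V v) = (2 : k) • SymmetricAlgebra.ι k V v := by
    intro v
    simp [Ψ, two_smul]
  have hLE : ∀ n, L ^ n ≤ E n := by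
    intro n
    induction n with
    | zero =>
      intro y hy
      rw [pow_zero] at hy
      obtain ⟨c, rfl⟩ := Submodule.mem_one.1 hy
      simp [E]
    | succ n ih =>
      rw [pow_succ, Submodule.mul_le]
      rintro a ha _ ⟨v, rfl⟩
      have h1 : Ψ a = (2 : k) ^ n • a := Module.End.mem_eigenspace_iff.1 (ih ha)
      refine Module.End.mem_eigenspace_iff.2 ?_
      rw [AlgHom.toLinearMap_apply, map_mul, h1, hΨ, smul_mul_smul_comm, pow_succ]
  have hind : iSupIndep E :=
    (Module.End.eigenspaces_iSupIndep Ψ.toLinearMap).comp (f := fun n : ℕ => (2 : k) ^ n)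
      (fun m n h => Nat.pow_right_injective le_rfl (by
        have h' : (2 : k) ^ m = (2 : k) ^ n := h
        exact_mod_cast h'))
  have htop : ∀ y : SymmetricAlgebra k V, y ∈ ⨆ n, L ^ n := by
    intro y
    obtain ⟨n, hn⟩ := exists_mem_symFil k V y
    have hle : ∀ n, symFil k V n ≤ ⨆ n, L ^ n := by
      intro n
      induction n with
      | zero => exact le_iSup_of_le 0 (by rw [symFil, pow_zero, pow_zero])
      | succ n ih =>
        rw [symFil, pow_succ]
        refine (mul_le_mul' ih (le_refl (1 ⊔ L))).trans ?_
        rw [Submodule.mul_sup, mul_one, Submodule.iSup_mul]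
        refine sup_le le_rfl (iSup_le fun i => ?_)
        rw [← pow_succ]
        exact le_iSup (fun n => L ^ n) (i + 1)
    exact hle n hn
  have hxE : x ∈ E 1 := by
    rw [mem_primitives] at hx
    refine Module.End.mem_eigenspace_iff.2 ?_
    simp [Ψ, hx, two_smul]
  obtain ⟨f, hf, hsum⟩ := (Submodule.mem_iSup_iff_exists_finsupp _ _).1 (htop x)
  have hsum' : f 1 + (f.erase 1).sum (fun _ y => y) = x := by
    rw [← hsum]
    by_cases h1 : (1 : ℕ) ∈ f.support
    · exact Finsupp.add_sum_erase f 1 (fun _ y => y) h1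
    · rw [Finsupp.erase_of_notMem_support h1, Finsupp.notMem_support_iff.1 h1, zero_add]
  have hrest : (f.erase 1).sum (fun _ y => y) ∈ ⨆ j, ⨆ (_ : j ≠ 1), E j := by
    refine Submodule.sum_mem _ fun i hi => ?_
    have hi1 : i ≠ 1 := by
      rintro rfl
      simp at hi
    rw [Finsupp.erase_ne hi1]
    exact Submodule.mem_iSup_of_mem i (Submodule.mem_iSup_of_mem hi1 (hLE i (hf i)))
  have hf1 : f 1 ∈ L := by simpa using hf 1
  have hrest' : (f.erase 1).sum (fun _ y => y) ∈ E 1 := by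
    rw [← eq_sub_iff_add_eq'] at hsum'
    rw [hsum']
    exact Submodule.sub_mem _ hxE (hLE 1 (hf 1))
  have h0 := Submodule.disjoint_def.1 (hind 1) _ hrest' hrest
  rw [← hsum', h0, add_zero]
  exact hf1

/-- The symmetric coalgebra `Sym^co(V)` of a finite-dimensional vector space (characteristic
zero): the symmetric algebra with the (unshuffle) comultiplication for which
`Δ v = v ⊗ 1 + 1 ⊗ v`, `v ∈ V`, and `Δ` is multiplicative. -/
def symCo [CharZero k] [Module.Finite k V] : CoCom k where
  carrier := SymmetricAlgebra k V
  pt := 1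
  isConilpotent := isConilpotent_sym k V
  finiteType := Submodule.finiteDimensional_of_le (primitives_sym_le k V)

/-- The projection `Sym^co(V) → V`. -/
def symCo.proj [CharZero k] [Module.Finite k V] : (symCo k V).carrier →ₗ[k] V :=
  symProj k V

end Sym

/-- A coalgebra `S` with a linear map `π : S → V` that vanishes at the base point is cofree on `V`
if every linear map `φ : D → V` from a conilpotent cocommutative coalgebra `D` (with base point `d`,
not necessarily of finite type) that vanishes at the base point lifts uniquely to a coalgebra
morphism `D → S`. -/
structure IsCofree {V : Type u} [AddCommGroup V] [Module k V] (S : CoCom k)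
    (π : S.carrier →ₗ[k] V) : Prop where
  map_pt : π S.pt = 0
  existsUnique_lift : ∀ (D : Type u) [AddCommGroup D] [Module k D] [Coalgebra k D]
    [Coalgebra.IsCocomm k D] (d : D), IsConilpotent k d → ∀ φ : D →ₗ[k] V, φ d = 0 →
      ∃! F : D →ₗc[k] S.carrier, π ∘ₗ (F : D →ₗ[k] S.carrier) = φ

end FormalCoalg

end

/-! Everything rests on one translation, `formalSubmersions_eq_rlp`: a morphism is a formal
submersion exactly when it has the right lifting property against injections into finite-dimensional
coalgebras. A continuous homomorphism from `k[C]` to a discrete ring has finite-dimensional image,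
each element of which is a scalar plus a nilpotent. Test rings may therefore be replaced by
finite-dimensional augmented algebras with nilpotent augmentation ideal. These are dual to
finite-dimensional conilpotent coalgebras, and surjections of algebras become injections of
coalgebras. Finite type enters through `FunAlg.maxIdeal_fg`: it makes the powers of the maximal
ideal open for the topology of finite-dimensional subspaces, so that continuous algebra maps come
from coalgebra maps (`FunAlg.exists_map_eq`).

Since every object is a union of finite-dimensional subcoalgebras, Zorn's lemma extends the lifting
property to all injections (`exists_lift_of_injective`). Lifting the identity of `D` along its base
point gives each formal submersion a section. Surjectivity on primitives, effectivity and
cancellation follow, while composition and base change are formal for a class defined by lifting.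

Characteristic zero makes `Sym(V)` cofree: the morphism with linear part `φ` is the convolution
exponential of `φ`, and it is unique because the primitives of `Sym(V)` are `V`. A coalgebra embeds
into the symmetric coalgebra on its primitives, and pullbacks are largest subcoalgebras of symmetric
coalgebras. Morphisms into `Sym(V)` are linear maps, which extend along injections, so symmetric
coalgebras are formal manifolds. Conversely, the embedding of a formal manifold has a retraction
that is injective on primitives, hence an inverse. Finally, a morphism of formal manifolds that is
surjective on primitives becomes a linear projection in suitable coordinates. -/

noncomputable section

namespace FormalCoalg

/-! ### Tensors and linear functionals -/

section Tensor

variable {k X Y : Type u} [Field k] [AddCommGroup X] [Module k X] [AddCommGroup Y] [Module k Y]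

theorem apply_equivFinsuppOfBasisRight {κ : Type*} [DecidableEq κ] (b : Module.Basis κ k Y)
    (t : X ⊗[k] Y) (φ : X →ₗ[k] k) (j : κ) :
    φ (TensorProduct.equivFinsuppOfBasisRight b t j) =
      LinearMap.mul' k k (TensorProduct.map φ (b.coord j) t) := by
  induction t with
  | zero => simp
  | add x y hx hy => simp only [map_add, Finsupp.add_apply, hx, hy]
  | tmul x y =>
    rw [TensorProduct.equivFinsuppOfBasisRight_apply_tmul_apply, map_smul, TensorProduct.map_tmul,
      LinearMap.mul'_apply, Module.Basis.coord_apply, smul_eq_mul, mul_comm]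

theorem tensor_eq_zero_of_forall (t : X ⊗[k] Y)
    (h : ∀ (φ : X →ₗ[k] k) (ψ : Y →ₗ[k] k),
      LinearMap.mul' k k (TensorProduct.map φ ψ t) = 0) : t = 0 := by
  classical
  let b := Module.Basis.ofVectorSpace k Y
  apply (TensorProduct.equivFinsuppOfBasisRight b).injective
  rw [map_zero]
  ext j
  rw [Finsupp.zero_apply, ← Module.forall_dual_apply_eq_zero_iff k]
  intro φ
  rw [apply_equivFinsuppOfBasisRight]
  exact h _ _

theorem tensor_ext_of_forall {s t : X ⊗[k] Y}
    (h : ∀ (φ : X →ₗ[k] k) (ψ : Y →ₗ[k] k),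
      LinearMap.mul' k k (TensorProduct.map φ ψ s) =
        LinearMap.mul' k k (TensorProduct.map φ ψ t)) : s = t := by
  rw [← sub_eq_zero]
  refine tensor_eq_zero_of_forall _ fun φ ψ => ?_
  rw [map_sub, map_sub, h, sub_self]

theorem exists_projection (W : Submodule k X) :
    ∃ p : X →ₗ[k] W, p ∘ₗ W.subtype = LinearMap.id :=
  W.subtype.exists_leftInverse_of_injective W.ker_subtype

/-- Expand `t` along a basis of `Y`: each coefficient in `X` is killed by `M`, so it lies in `W`,
where `p` is the identity. -/
theorem rTensor_eq_self_of_forall (W : Submodule k X) (M : Set (X →ₗ[k] k))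
    (hM : ∀ x, (∀ φ ∈ M, φ x = 0) → x ∈ W) (p : X →ₗ[k] X) (hp : ∀ x ∈ W, p x = x)
    (t : X ⊗[k] Y)
    (h : ∀ φ ∈ M, ∀ ψ : Y →ₗ[k] k, LinearMap.mul' k k (TensorProduct.map φ ψ t) = 0) :
    TensorProduct.map p LinearMap.id t = t := by
  classical
  let b := Module.Basis.ofVectorSpace k Y
  obtain ⟨c, rfl⟩ := (TensorProduct.equivFinsuppOfBasisRight b).symm.surjective t
  have hc : ∀ j, c j ∈ W := fun j => hM _ fun φ hφ => by
    have := apply_equivFinsuppOfBasisRight b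
      ((TensorProduct.equivFinsuppOfBasisRight b).symm c) φ j
    rw [LinearEquiv.apply_symm_apply] at this
    rw [this]
    exact h _ hφ _
  rw [TensorProduct.equivFinsuppOfBasisRight_symm_apply, Finsupp.sum, map_sum]
  refine Finset.sum_congr rfl fun j _ => ?_
  rw [TensorProduct.map_tmul, hp _ (hc j), LinearMap.id_apply]

/-- A tensor killed on either side by a family of functionals lies in the tensor square of the
common kernel. -/
theorem mem_range_map_of_forall (W : Submodule k X) (M : Set (X →ₗ[k] k))
    (hM : ∀ x, (∀ φ ∈ M, φ x = 0) → x ∈ W) (t : X ⊗[k] X)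
    (h₁ : ∀ φ ∈ M, ∀ ψ : X →ₗ[k] k, LinearMap.mul' k k (TensorProduct.map φ ψ t) = 0)
    (h₂ : ∀ φ ∈ M, ∀ ψ : X →ₗ[k] k, LinearMap.mul' k k (TensorProduct.map ψ φ t) = 0) :
    t ∈ LinearMap.range (TensorProduct.map W.subtype W.subtype) := by
  obtain ⟨p, hp⟩ := exists_projection W
  have hp' : ∀ x ∈ W, (W.subtype ∘ₗ p) x = x := fun x hx => by
    have := LinearMap.congr_fun hp ⟨x, hx⟩
    exact congrArg Subtype.val this
  -- A projection onto `W` fixes `t` in the first factor, and by the swapped tensor also in the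
  -- second; hence `t` is the image of `(p ⊗ p) t`.
  have e₁ := rTensor_eq_self_of_forall W M hM _ hp' t h₁
  have e₂ := rTensor_eq_self_of_forall W M hM _ hp' (TensorProduct.comm k X X t) (by
    intro φ hφ ψ
    rw [← h₂ φ hφ ψ, TensorProduct.map_comm]
    exact LinearMap.mul'_comm _)
  rw [TensorProduct.map_comm, EmbeddingLike.apply_eq_iff_eq] at e₂
  refine ⟨TensorProduct.map p p t, ?_⟩
  rw [← LinearMap.comp_apply, ← TensorProduct.map_comp]
  conv_rhs => rw [← e₁, ← e₂]
  rw [← LinearMap.comp_apply, ← TensorProduct.map_comp, LinearMap.id_comp, LinearMap.comp_id]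

theorem mul'_map_eq_zero_of_mem_range (F : Submodule k X) {φ ψ : X →ₗ[k] k}
    (h : F ≤ LinearMap.ker φ ∨ F ≤ LinearMap.ker ψ) {t : X ⊗[k] X}
    (ht : t ∈ LinearMap.range (TensorProduct.map F.subtype F.subtype)) :
    LinearMap.mul' k k (TensorProduct.map φ ψ t) = 0 := by
  refine range_map_le k F (LinearMap.ker (LinearMap.mul' k k ∘ₗ TensorProduct.map φ ψ)) ?_ ht
  intro a ha b hb
  rcases h with h | h
  · simp [LinearMap.mem_ker.1 (h ha)]
  · simp [LinearMap.mem_ker.1 (h hb)]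

theorem range_map_mono {F G : Submodule k X} (h : F ≤ G) :
    LinearMap.range (TensorProduct.map F.subtype F.subtype) ≤
      LinearMap.range (TensorProduct.map G.subtype G.subtype) :=
  range_map_le k _ _ fun _ ha _ hb => tmul_mem_range_map k _ (h ha) (h hb)

/-- The functionals `φ' ∘ i` with `φ'` vanishing on `F` cut out the preimage of `F`. A left inverse
of `i` extends the arbitrary functional on the other factor to `Y`, where the hypothesis applies. -/
theorem mem_range_map_comap (i : X →ₗ[k] Y) (hi : Function.Injective i) (F : Submodule k Y)
    (t : X ⊗[k] X)
    (h : TensorProduct.map i i t ∈ LinearMap.range (TensorProduct.map F.subtype F.subtype)) :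
    t ∈ LinearMap.range
      (TensorProduct.map (F.comap i).subtype (F.comap i).subtype) := by
  obtain ⟨r, hr⟩ := i.exists_leftInverse_of_injective (LinearMap.ker_eq_bot.2 hi)
  refine mem_range_map_of_forall _ {φ | ∃ φ' : Y →ₗ[k] k, F ≤ LinearMap.ker φ' ∧ φ = φ' ∘ₗ i}
    ?_ t ?_ ?_
  · intro x hx
    by_contra hxF
    obtain ⟨f, hf, hF⟩ := Submodule.exists_le_ker_of_notMem (p := F) (v := i x) hxF
    exact hf (hx _ ⟨f, hF, rfl⟩)
  · rintro _ ⟨φ, hφ, rfl⟩ ψ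
    have := mul'_map_eq_zero_of_mem_range F (φ := φ) (ψ := ψ ∘ₗ r) (Or.inl hφ) h
    rwa [← LinearMap.comp_apply (TensorProduct.map _ _), ← TensorProduct.map_comp,
      LinearMap.comp_assoc, hr, LinearMap.comp_id] at this
  · rintro _ ⟨φ, hφ, rfl⟩ ψ
    have := mul'_map_eq_zero_of_mem_range F (φ := ψ ∘ₗ r) (ψ := φ) (Or.inr hφ) h
    rwa [← LinearMap.comp_apply (TensorProduct.map _ _), ← TensorProduct.map_comp,
      LinearMap.comp_assoc, hr, LinearMap.comp_id] at this

theorem map_injective_of_injective {X' Y' : Type u} [AddCommGroup X'] [Module k X']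
    [AddCommGroup Y'] [Module k Y'] {f : X →ₗ[k] X'} {g : Y →ₗ[k] Y'}
    (hf : Function.Injective f) (hg : Function.Injective g) :
    Function.Injective (TensorProduct.map f g) :=
  TensorProduct.map_injective_of_flat_flat f g hf hg

end Tensor

/-! ### Conilpotent coalgebras -/

section Conilpotent

variable {k C D : Type u} [Field k]
  [AddCommGroup C] [Module k C] [Coalgebra k C] [AddCommGroup D] [Module k D] [Coalgebra k D]

theorem reducedComul_self {e : C} (he : IsGroupLikeElem k e) :
    reducedComul k e e = -(e ⊗ₜ[k] e) := by
  rw [reducedComul_apply, he.comul_eq_tmul_self]; abel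

theorem comul_eq_reducedComul (e x : C) :
    Coalgebra.comul (R := k) x = reducedComul k e x + x ⊗ₜ[k] e + e ⊗ₜ[k] x := by
  rw [reducedComul_apply]; abel

theorem map_reducedComul (f : C →ₗc[k] D) (e x : C) :
    TensorProduct.map (f : C →ₗ[k] D) (f : C →ₗ[k] D) (reducedComul k e x) =
      reducedComul k (f e) (f x) := by
  have h := CoalgHomClass.map_comp_comul_apply f x
  rw [reducedComul_apply, reducedComul_apply, ← h]
  simp

theorem primFiltration_le_succ {e : C} (he : IsGroupLikeElem k e) (n : ℕ) :
    primFiltration k e n ≤ primFiltration k e (n + 1) := by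
  induction n with
  | zero =>
    rw [primFiltration, Submodule.span_singleton_le_iff_mem, primFiltration,
      Submodule.mem_comap, reducedComul_self he]
    have := Submodule.mem_span_singleton_self (R := k) e
    exact Submodule.neg_mem _ (tmul_mem_range_map k _ this this)
  | succ n ih =>
    intro x hx
    exact range_map_mono ih hx

theorem primFiltration_mono {e : C} (he : IsGroupLikeElem k e) :
    Monotone (primFiltration k e) :=
  monotone_nat_of_le_succ (primFiltration_le_succ he)

theorem self_mem_primFiltration {e : C} (he : IsGroupLikeElem k e) (n : ℕ) :
    e ∈ primFiltration k e n :=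
  primFiltration_mono he n.zero_le (Submodule.mem_span_singleton_self e)

/-- A subspace `W` with `Δ W ⊆ W ⊗ W`. -/
def IsSubcoalgebra (k : Type u) [Field k] [Module k C] [Coalgebra k C] (W : Submodule k C) :
    Prop :=
  ∀ x ∈ W, Coalgebra.comul (R := k) x ∈
    LinearMap.range (TensorProduct.map W.subtype W.subtype)

/-- With `finite_primFiltration`, this exhausts an object by finite-dimensional subcoalgebras. -/
theorem isSubcoalgebra_primFiltration {e : C} (he : IsGroupLikeElem k e) (n : ℕ) :
    IsSubcoalgebra k (primFiltration k e n) := by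
  intro x hx
  rw [comul_eq_reducedComul e]
  have he' := self_mem_primFiltration he n
  refine Submodule.add_mem _ (Submodule.add_mem _ ?_ (tmul_mem_range_map k _ hx he'))
    (tmul_mem_range_map k _ he' hx)
  cases n with
  | zero =>
    obtain ⟨c, rfl⟩ := Submodule.mem_span_singleton.1 hx
    rw [map_smul, reducedComul_self he]
    exact Submodule.smul_mem _ _ (Submodule.neg_mem _ (tmul_mem_range_map k _ he' he'))
  | succ n => exact range_map_mono (primFiltration_le_succ he n) hx

theorem isSubcoalgebra_sSup {S : Set (Submodule k C)} (h : ∀ W ∈ S, IsSubcoalgebra k W) :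
    IsSubcoalgebra k (sSup S) := by
  intro x hx
  have : sSup S ≤ (LinearMap.range (TensorProduct.map (sSup S).subtype (sSup S).subtype)).comap
      (Coalgebra.comul (R := k)) :=
    sSup_le fun W hW y hy => range_map_mono (le_sSup hW) (h W hW y hy)
  exact this hx

theorem isSubcoalgebra_span_singleton {e : C} (he : IsGroupLikeElem k e) :
    IsSubcoalgebra k (Submodule.span k {e}) :=
  isSubcoalgebra_primFiltration he 0

theorem isSubcoalgebra_range (f : C →ₗc[k] D) :
    IsSubcoalgebra k (LinearMap.range (f : C →ₗ[k] D)) := by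
  rintro _ ⟨x, rfl⟩
  have h := CoalgHomClass.map_comp_comul_apply f x
  have h' : Coalgebra.comul (R := k) ((f : C →ₗ[k] D) x) =
    TensorProduct.map (f : C →ₗ[k] D) (f : C →ₗ[k] D) (Coalgebra.comul (R := k) x) := h.symm
  rw [h']
  generalize Coalgebra.comul (R := k) x = t
  induction t with
  | zero => simp
  | add a b ha hb => rw [map_add]; exact Submodule.add_mem _ ha hb
  | tmul a b => exact tmul_mem_range_map k _ ⟨a, rfl⟩ ⟨b, rfl⟩

/-- Injectivity on primitives implies injectivity. -/
theorem IsConilpotent.injective {e : C} (he : IsConilpotent k e) (f : C →ₗc[k] D)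
    (hf : ∀ x ∈ primitives k e, f x = 0 → x = 0) : Function.Injective f := by
  have hfe : f e ≠ 0 := fun h => by
    have := CoalgHomClass.counit_comp_apply f e
    rw [h, map_zero, he.isGroupLike.counit_eq_one] at this
    exact zero_ne_one this
  have key : ∀ n, ∀ x ∈ primFiltration k e n, f x = 0 → x = 0 := by
    intro n
    induction n with
    | zero =>
      intro x hx h
      obtain ⟨c, rfl⟩ := Submodule.mem_span_singleton.1 hx
      rw [map_smul, smul_eq_zero_iff_left hfe] at h
      rw [h, zero_smul]
    | succ n ih =>
      intro x hx h
      refine hf x ?_ h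
      -- If `f x = 0`, then `f ⊗ f` kills the reduced comultiplication of `x`. By induction `f ⊗ f`
      -- is injective on `Fₙ ⊗ Fₙ`, so `x` is primitive.
      obtain ⟨t, ht⟩ := hx
      rw [primitives, LinearMap.mem_ker, ← ht]
      have h1 := map_reducedComul f e x
      rw [h, map_zero, ← ht, ← LinearMap.comp_apply, ← TensorProduct.map_comp] at h1
      have hinj : Function.Injective ((f : C →ₗ[k] D) ∘ₗ (primFiltration k e n).subtype) := by
        rw [injective_iff_map_eq_zero]
        rintro ⟨y, hy⟩ hy0
        exact Subtype.ext (ih y hy hy0)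
      rw [(injective_iff_map_eq_zero _).1 (map_injective_of_injective hinj hinj) t h1, map_zero]
  rw [injective_iff_map_eq_zero]
  intro x
  obtain ⟨n, hn⟩ := he.exhaustive x
  exact key n x hn

/-- The preimage of each filtration step of `D` lies in the same step of `C`, by
`mem_range_map_comap`. -/
theorem IsConilpotent.of_injective {e : C} {e' : D} (he : IsGroupLikeElem k e)
    (he' : IsConilpotent k e') (f : C →ₗc[k] D) (hf : Function.Injective f) :
    IsConilpotent k e := by
  have hfe : f e = e' := he'.eq_of_isGroupLike (he.map f)
  refine ⟨he, fun x => ?_⟩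
  have key : ∀ n, (primFiltration k e' n).comap (f : C →ₗ[k] D) ≤ primFiltration k e n := by
    intro n
    induction n with
    | zero =>
      intro x hx
      obtain ⟨c, hc⟩ := Submodule.mem_span_singleton.1 hx
      refine Submodule.mem_span_singleton.2 ⟨c, hf ?_⟩
      rw [map_smul, hfe, hc]; rfl
    | succ n ih =>
      intro x hx
      have h1 : reducedComul k e' (f x) ∈ LinearMap.range (TensorProduct.map
        (primFiltration k e' n).subtype (primFiltration k e' n).subtype) := hx
      rw [← hfe, ← map_reducedComul, hfe] at h1
      exact range_map_mono ih (mem_range_map_comap _ hf _ _ h1)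
  obtain ⟨n, hn⟩ := he'.exhaustive (f x)
  exact ⟨n, key n hn⟩

/-- The reduced comultiplication sends `Fₙ₊₁` into the finite-dimensional `Fₙ ⊗ Fₙ`, and its kernel
consists of primitives. -/
theorem finite_primFiltration {e : C} [Module.Finite k (primitives k e)] (n : ℕ) :
    Module.Finite k (primFiltration k e n) := by
  induction n with
  | zero => exact inferInstanceAs (Module.Finite k (Submodule.span k {e}))
  | succ n ih =>
    rw [Module.Finite.iff_fg]
    refine Submodule.fg_of_fg_map_of_fg_inf_ker (reducedComul k e) ?_ ?_
    · rw [← Module.Finite.iff_fg]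
      exact Submodule.finiteDimensional_of_le
        (S₂ := LinearMap.range (TensorProduct.map (primFiltration k e n).subtype
          (primFiltration k e n).subtype)) (Submodule.map_le_iff_le_comap.2 le_rfl)
    · rw [← Module.Finite.iff_fg]
      exact Submodule.finiteDimensional_of_le (S₂ := primitives k e) inf_le_right

end Conilpotent

/-! ### Subcoalgebras -/

section Sub

variable {k C : Type u} [Field k] [AddCommGroup C] [Module k C] [Coalgebra k C]

theorem exists_comul_sub {W : Submodule k C} (hW : IsSubcoalgebra k W) :
    ∃ δ : W →ₗ[k] W ⊗[k] W, ∀ w : W,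
      TensorProduct.map W.subtype W.subtype (δ w) = Coalgebra.comul (R := k) (w : C) := by
  obtain ⟨p, hp⟩ := exists_projection W
  refine ⟨TensorProduct.map p p ∘ₗ Coalgebra.comul ∘ₗ W.subtype, fun w => ?_⟩
  obtain ⟨t, ht⟩ := hW w w.2
  rw [LinearMap.comp_apply, LinearMap.comp_apply, Submodule.subtype_apply, ← ht,
    ← LinearMap.comp_apply (TensorProduct.map p p), ← TensorProduct.map_comp, hp,
    TensorProduct.map_id, LinearMap.id_apply]

/-- The coalgebra structure on a subcoalgebra. -/
@[reducible] def subcoalgebra {W : Submodule k C} (hW : IsSubcoalgebra k W) : Coalgebra k W :=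
  let δ := (exists_comul_sub hW).choose
  have hδ : TensorProduct.map W.subtype W.subtype ∘ₗ δ = Coalgebra.comul (R := k) ∘ₗ W.subtype :=
    LinearMap.ext (exists_comul_sub hW).choose_spec
  have hinj : Function.Injective W.subtype := W.subtype_injective
  { comul := δ
    counit := Coalgebra.counit (R := k) ∘ₗ W.subtype
    coassoc := by
      ext w
      -- Tensor powers of `W` inject into those of `C`, so each coalgebra axiom may be checked in
      -- `C`.
      apply map_injective_of_injective hinj (map_injective_of_injective hinj hinj)
      have h1 : ∀ t, TensorProduct.map W.subtype (TensorProduct.map W.subtype W.subtype)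
          (TensorProduct.assoc k W W W (δ.rTensor W t)) =
          TensorProduct.assoc k C C C ((Coalgebra.comul (R := k)).rTensor C
            (TensorProduct.map W.subtype W.subtype t)) := by
        intro t
        induction t with
        | zero => simp
        | add a b ha hb => simp only [map_add, ha, hb]
        | tmul a b =>
          rw [LinearMap.rTensor_tmul, TensorProduct.map_tmul, LinearMap.rTensor_tmul,
            ← LinearMap.comp_apply Coalgebra.comul, ← hδ, LinearMap.comp_apply]
          generalize δ a = s
          induction s with
          | zero => simp
          | add a b ha hb => simp only [map_add, TensorProduct.add_tmul, ha, hb]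
          | tmul a b => simp
      have h2 : ∀ t, TensorProduct.map W.subtype (TensorProduct.map W.subtype W.subtype)
          (δ.lTensor W t) = (Coalgebra.comul (R := k)).lTensor C
            (TensorProduct.map W.subtype W.subtype t) := by
        intro t
        induction t with
        | zero => simp
        | add a b ha hb => simp only [map_add, ha, hb]
        | tmul a b =>
          rw [LinearMap.lTensor_tmul, TensorProduct.map_tmul, TensorProduct.map_tmul,
            LinearMap.lTensor_tmul, ← LinearMap.comp_apply Coalgebra.comul, ← hδ,
            LinearMap.comp_apply]
      have h3 := LinearMap.congr_fun hδ w
      simp only [LinearMap.comp_apply] at h3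
      simp only [LinearMap.comp_apply, LinearEquiv.coe_coe]
      rw [h1, h2, h3, Coalgebra.coassoc_apply]
    rTensor_counit_comp_comul := by
      ext w
      apply map_injective_of_injective (f := LinearMap.id) Function.injective_id hinj
      have h1 : ∀ t, TensorProduct.map LinearMap.id W.subtype
          ((Coalgebra.counit (R := k) ∘ₗ W.subtype).rTensor W t) =
          (Coalgebra.counit (R := k)).rTensor C (TensorProduct.map W.subtype W.subtype t) := by
        intro t
        induction t with
        | zero => simp
        | add a b ha hb => simp only [map_add, ha, hb]
        | tmul a b => simp
      have h3 := LinearMap.congr_fun hδ w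
      simp only [LinearMap.comp_apply] at h3
      rw [LinearMap.comp_apply, h1, h3, Coalgebra.rTensor_counit_comul]
      simp
    lTensor_counit_comp_comul := by
      ext w
      apply map_injective_of_injective (g := LinearMap.id) hinj Function.injective_id
      have h1 : ∀ t, TensorProduct.map W.subtype LinearMap.id
          ((Coalgebra.counit (R := k) ∘ₗ W.subtype).lTensor W t) =
          (Coalgebra.counit (R := k)).lTensor C (TensorProduct.map W.subtype W.subtype t) := by
        intro t
        induction t with
        | zero => simp
        | add a b ha hb => simp only [map_add, ha, hb]
        | tmul a b => simp
      have h3 := LinearMap.congr_fun hδ w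
      simp only [LinearMap.comp_apply] at h3
      rw [LinearMap.comp_apply, h1, h3, Coalgebra.lTensor_counit_comul]
      simp }

theorem map_comul_subcoalgebra {W : Submodule k C} (hW : IsSubcoalgebra k W) (w : W) :
    TensorProduct.map W.subtype W.subtype ((subcoalgebra hW).comul w) =
      Coalgebra.comul (R := k) (w : C) :=
  (exists_comul_sub hW).choose_spec w

theorem isCocomm_subcoalgebra [Coalgebra.IsCocomm k C] {W : Submodule k C}
    (hW : IsSubcoalgebra k W) : letI := subcoalgebra hW; Coalgebra.IsCocomm k W := by
  let := subcoalgebra hW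
  refine ⟨LinearMap.ext fun w => ?_⟩
  apply map_injective_of_injective W.subtype_injective W.subtype_injective
  rw [LinearMap.comp_apply, LinearEquiv.coe_coe, TensorProduct.map_comm,
    map_comul_subcoalgebra hW, Coalgebra.comm_comul]

end Sub

/-! ### Subcoalgebras as objects, and factorization through injective morphisms -/

namespace CoCom

variable {k : Type u} [Field k] {C D : CoCom k}

theorem hom_ext {f g : C ⟶ D} (h : ∀ x, f.hom x = g.hom x) : f = g :=
  CoCom.Hom.ext (DFunLike.ext _ _ h)

@[simp] theorem comp_hom_apply {E : CoCom k} (f : C ⟶ D) (g : D ⟶ E) (x : C.carrier) :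
    (f ≫ g).hom x = g.hom (f.hom x) := rfl

/-- A subcoalgebra that contains the base point, as an object. -/
def sub (C : CoCom k) (W : Submodule k C.carrier) (hW : IsSubcoalgebra k W) (hpt : C.pt ∈ W) :
    CoCom k :=
  letI := subcoalgebra hW
  haveI := isCocomm_subcoalgebra hW
  let ι : W →ₗc[k] C.carrier :=
    { W.subtype with
      counit_comp := rfl
      map_comp_comul := LinearMap.ext (map_comul_subcoalgebra hW) }
  have hgl : IsGroupLikeElem k (⟨C.pt, hpt⟩ : W) :=
    ⟨C.isConilpotent.isGroupLike.counit_eq_one, by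
      apply map_injective_of_injective W.subtype_injective W.subtype_injective
      rw [map_comul_subcoalgebra hW]
      simp [C.isConilpotent.isGroupLike.comul_eq_tmul_self]⟩
  { carrier := W
    pt := ⟨C.pt, hpt⟩
    isConilpotent := C.isConilpotent.of_injective hgl ι W.subtype_injective
    finiteType := by
      have := C.finiteType
      refine Module.Finite.of_injective (W.subtype.restrict (p := primitives k _)
        (q := primitives k C.pt) fun x hx => ?_) ?_
      · rw [primitives, LinearMap.mem_ker] at hx ⊢
        have := map_reducedComul ι ⟨C.pt, hpt⟩ x
        rw [hx, map_zero] at this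
        exact this.symm
      · intro x y h
        have h' := congrArg (fun z : primitives k C.pt => (z : C.carrier)) h
        exact Subtype.ext (Subtype.ext h') }

section sub

variable (W : Submodule k C.carrier) (hW : IsSubcoalgebra k W) (hpt : C.pt ∈ W)

/-- The inclusion of a subcoalgebra. -/
def subι : C.sub W hW hpt ⟶ C :=
  CoCom.Hom.mk (C := C.sub W hW hpt)
    { W.subtype with
      counit_comp := rfl
      map_comp_comul := LinearMap.ext (map_comul_subcoalgebra hW) }

theorem subι_injective : Function.Injective (C.subι W hW hpt).hom :=
  W.subtype_injective

theorem subι_mem (x : (C.sub W hW hpt).carrier) : (C.subι W hW hpt).hom x ∈ W := x.2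

theorem mem_range_subι {x : C.carrier} (hx : x ∈ W) :
    ∃ y, (C.subι W hW hpt).hom y = x := ⟨⟨x, hx⟩, rfl⟩

end sub

/-- Factorization of a morphism through an injective morphism. -/
theorem exists_factor {T : CoCom k} (i : C ⟶ D) (hi : Function.Injective i.hom) (g : T ⟶ D)
    (h : ∀ x, ∃ y, i.hom y = g.hom x) : ∃ g' : T ⟶ C, g' ≫ i = g := by
  obtain ⟨r, hr⟩ := (i.hom : C.carrier →ₗ[k] D.carrier).exists_leftInverse_of_injective
    (LinearMap.ker_eq_bot.2 hi)
  -- The left inverse `r` is only linear, but `i ∘ g₀ = g`. Injectivity of `i` and `i ⊗ i` then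
  -- forces `g₀` to respect the coalgebra structures.
  let g₀ : T.carrier →ₗ[k] C.carrier := r ∘ₗ (g.hom : T.carrier →ₗ[k] D.carrier)
  have hg₀ : ∀ x, i.hom (g₀ x) = g.hom x := by
    intro x
    obtain ⟨y, hy⟩ := h x
    have h1 : g₀ x = y := by
      have := LinearMap.congr_fun hr y
      simp only [LinearMap.comp_apply, LinearMap.id_apply] at this
      rw [← this]
      exact congrArg r hy.symm
    rw [h1, hy]
  have hg₀' : (i.hom : C.carrier →ₗ[k] D.carrier) ∘ₗ g₀ = (g.hom : T.carrier →ₗ[k] D.carrier) :=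
    LinearMap.ext hg₀
  refine ⟨⟨{ g₀ with counit_comp := ?_, map_comp_comul := ?_ }⟩, hom_ext hg₀⟩
  · ext x
    change Coalgebra.counit (R := k) (g₀ x) = _
    rw [← CoalgHomClass.counit_comp_apply i.hom, hg₀, CoalgHomClass.counit_comp_apply]
  · ext x
    apply map_injective_of_injective (f := (i.hom : C.carrier →ₗ[k] D.carrier))
      (g := (i.hom : C.carrier →ₗ[k] D.carrier)) hi hi
    change TensorProduct.map _ _ (TensorProduct.map g₀ g₀ (Coalgebra.comul (R := k) x)) =
      TensorProduct.map _ _ (Coalgebra.comul (R := k) (g₀ x))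
    have h1 := CoalgHomClass.map_comp_comul_apply i.hom (g₀ x)
    have h2 := CoalgHomClass.map_comp_comul_apply g.hom x
    rw [← LinearMap.comp_apply, ← TensorProduct.map_comp, hg₀']
    refine h2.trans (Eq.trans ?_ h1.symm)
    rw [hg₀]

theorem injective_of_prim {f : C ⟶ D} (h : Function.Injective (Prim.map f)) :
    Function.Injective f.hom :=
  C.isConilpotent.injective f.hom fun x hx h0 => by
    have : (⟨x, hx⟩ : Prim C) = 0 := h (Subtype.ext (by rw [map_zero]; exact h0))
    exact congrArg Subtype.val this

theorem prim_map_injective {f : C ⟶ D} (h : Function.Injective f.hom) :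
    Function.Injective (Prim.map f) := fun _ _ hxy =>
  Subtype.ext (h (congrArg Subtype.val hxy))

end CoCom

/-! ### The exponential in the convolution algebra -/

section ConvExp

open Polynomial

variable {k D A B : Type u} [Field k] [AddCommGroup D] [Module k D] [Coalgebra k D]
  [CommRing A] [Algebra k A] [CommRing B] [Algebra k B]

theorem convMul_apply_groupLike {e : D} (he : IsGroupLikeElem k e)
    (a b : WithConv (D →ₗ[k] A)) : (a * b) e = a e * b e := by
  rw [LinearMap.convMul_apply, he.comul_eq_tmul_self, TensorProduct.map_tmul,
    LinearMap.mul'_apply]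

/-- On `Fₙ₊₁` the comultiplication is a tensor in `Fₙ ⊗ Fₙ` plus `x ⊗ e + e ⊗ x`, and `e` lies in
`Fₙ`. -/
theorem convMul_apply_eq_zero {e : D} (he : IsGroupLikeElem k e) (n : ℕ)
    (a b : WithConv (D →ₗ[k] A)) (ha : ∀ x ∈ primFiltration k e n, a x = 0)
    (hb : ∀ x ∈ primFiltration k e n, b x = 0) :
    ∀ x ∈ primFiltration k e (n + 1), (a * b) x = 0 := by
  intro x hx
  have hred : reducedComul k e x ∈ LinearMap.ker (LinearMap.mul' k A ∘ₗ
      TensorProduct.map a.ofConv b.ofConv) := by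
    refine range_map_le k _ _ ?_ hx
    intro y hy z _
    rw [LinearMap.mem_ker, LinearMap.comp_apply, TensorProduct.map_tmul, ha y hy,
      TensorProduct.zero_tmul, map_zero]
  have he0 := self_mem_primFiltration he n
  rw [LinearMap.convMul_apply, comul_eq_reducedComul e, map_add, map_add, map_add, map_add,
    ← LinearMap.comp_apply, LinearMap.mem_ker.1 hred, TensorProduct.map_tmul,
    TensorProduct.map_tmul, ha e he0, hb e he0]
  simp

/-- The exponent doubles at each filtration step, because `φ ^ (2 ^ (n + 1))` is a product of two
powers that vanish on `Fₙ`. This local nilpotence makes the exponential series finite. -/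
theorem convPow_apply_eq_zero {e : D} (he : IsGroupLikeElem k e) (φ : WithConv (D →ₗ[k] A))
    (hφ : φ e = 0) (n : ℕ) : ∀ m, 2 ^ n ≤ m → ∀ x ∈ primFiltration k e n, (φ ^ m) x = 0 := by
  induction n with
  | zero =>
    intro m hm x hx
    obtain ⟨c, rfl⟩ := Submodule.mem_span_singleton.1 hx
    obtain ⟨m, rfl⟩ := Nat.exists_eq_add_of_le hm
    rw [map_smul, pow_zero, pow_add, pow_one, convMul_apply_groupLike he, hφ, zero_mul, smul_zero]
  | succ n ih =>
    intro m hm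
    obtain ⟨m, rfl⟩ := Nat.exists_eq_add_of_le hm
    rw [pow_succ, mul_two, add_assoc, pow_add]
    exact convMul_apply_eq_zero he n _ _ (ih _ le_rfl) (ih _ (Nat.le_add_right _ _))

variable {e : D}

/-- A formal variable keeps the convolution powers apart, so identities between exponentials can be
checked degree by degree. -/
theorem exists_convExpPoly (he : IsConilpotent k e) (φ : WithConv (D →ₗ[k] A)) (hφ : φ e = 0) :
    ∃ P : D →ₗ[k] A[X], ∀ x n, (P x).coeff n = (n.factorial : k)⁻¹ • (φ ^ n) x := by
  choose N hN using he.exhaustive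
  -- The cut-off `2 ^ N x` depends on a choice for each `x`, but the coefficients do not; linearity
  -- is therefore checked on coefficients.
  have h : ∀ x n, (∑ i ∈ Finset.range (2 ^ N x),
      monomial i ((i.factorial : k)⁻¹ • (φ ^ i) x)).coeff n =
      (n.factorial : k)⁻¹ • (φ ^ n) x := by
    intro x n
    simp only [finsetSum_coeff, coeff_monomial, Finset.sum_ite_eq', Finset.mem_range]
    split_ifs with hn
    · rfl
    · rw [convPow_apply_eq_zero he.isGroupLike φ hφ _ n (not_lt.1 hn) x (hN x), smul_zero]
  refine ⟨{ toFun := fun x => ∑ i ∈ Finset.range (2 ^ N x),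
              monomial i ((i.factorial : k)⁻¹ • (φ ^ i) x)
            map_add' := fun x y => ?_
            map_smul' := fun c x => ?_ }, h⟩
  · ext n
    rw [coeff_add, h, h, h, map_add, smul_add]
  · ext n
    rw [coeff_smul, h, h, map_smul, RingHom.id_apply, smul_comm]

/-- The polynomial `∑ φⁿ / n! Tⁿ` in the convolution powers of `φ`. -/
def convExpPoly (he : IsConilpotent k e) (φ : WithConv (D →ₗ[k] A)) (hφ : φ e = 0) :
    D →ₗ[k] A[X] :=
  (exists_convExpPoly he φ hφ).choose

theorem coeff_convExpPoly (he : IsConilpotent k e) (φ : WithConv (D →ₗ[k] A)) (hφ : φ e = 0)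
    (x : D) (n : ℕ) :
    (convExpPoly he φ hφ x).coeff n = (n.factorial : k)⁻¹ • (φ ^ n) x :=
  (exists_convExpPoly he φ hφ).choose_spec x n

variable (k A) in
/-- Evaluation of polynomials at `1`. -/
def evalOne : A[X] →ₐ[k] A := (Polynomial.aeval (R := A) (1 : A)).restrictScalars k

/-- The exponential of `φ` for the convolution product. -/
def convExp (he : IsConilpotent k e) (φ : WithConv (D →ₗ[k] A)) (hφ : φ e = 0) :
    WithConv (D →ₗ[k] A) :=
  WithConv.toConv ((evalOne k A).toLinearMap ∘ₗ convExpPoly he φ hφ)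

/-- Cocommutativity makes the convolution algebra commutative, so the binomial theorem applies.
Dividing by factorials gives the identity of polynomials, which is then evaluated at `1`. -/
theorem convExp_add [CharZero k] [Coalgebra.IsCocomm k D] (he : IsConilpotent k e)
    (φ ψ : WithConv (D →ₗ[k] A)) (hφ : φ e = 0) (hψ : ψ e = 0) (h : (φ + ψ) e = 0) :
    convExp he (φ + ψ) h = convExp he φ hφ * convExp he ψ hψ := by
  have key : WithConv.toConv (convExpPoly he (φ + ψ) h) =
      WithConv.toConv (convExpPoly he φ hφ) * WithConv.toConv (convExpPoly he ψ hψ) := by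
    ext x n
    change (convExpPoly he (φ + ψ) h x).coeff n =
      ((WithConv.toConv (convExpPoly he φ hφ) * WithConv.toConv (convExpPoly he ψ hψ)) x).coeff n
    rw [(Coalgebra.Repr.arbitrary k x).convMul_apply, finsetSum_coeff, coeff_convExpPoly,
      (Commute.all φ ψ).add_pow']
    simp only [coeff_mul, coeff_convExpPoly]
    rw [Finset.sum_comm]
    have hsum : ∀ f : ℕ × ℕ → WithConv (D →ₗ[k] A), ∀ s : Finset (ℕ × ℕ),
        (∑ p ∈ s, f p) x = ∑ p ∈ s, f p x := fun f s => by
      rw [WithConv.ofConv_sum, LinearMap.sum_apply]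
    rw [hsum, Finset.smul_sum]
    refine Finset.sum_congr rfl fun p hp => ?_
    rw [Finset.HasAntidiagonal.mem_antidiagonal] at hp
    have hfac : (n.factorial : k)⁻¹ * (n.choose p.1 : k) =
        (p.1.factorial : k)⁻¹ * (p.2.factorial : k)⁻¹ := by
      have h1 : ((n.choose p.1 * p.1.factorial * p.2.factorial : ℕ) : k) = n.factorial := by
        rw [← hp, add_comm p.1, mul_right_comm, Nat.add_choose_mul_factorial_mul_factorial]
      push_cast at h1
      have h2 : (n.factorial : k) ≠ 0 := by exact_mod_cast n.factorial_ne_zero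
      have h3 : (p.1.factorial : k) ≠ 0 := by exact_mod_cast p.1.factorial_ne_zero
      have h4 : (p.2.factorial : k) ≠ 0 := by exact_mod_cast p.2.factorial_ne_zero
      field_simp
      linear_combination h1
    have hns : (n.choose p.1 • (φ ^ p.1 * ψ ^ p.2)) x =
        (n.choose p.1 : k) • (φ ^ p.1 * ψ ^ p.2) x := by
      rw [← Nat.cast_smul_eq_nsmul k]
      rfl
    rw [hns, smul_smul, hfac, (Coalgebra.Repr.arbitrary k x).convMul_apply, Finset.smul_sum]
    refine Finset.sum_congr rfl fun i _ => ?_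
    rw [smul_mul_smul_comm]
  have := LinearMap.algHom_comp_convMul_distrib (evalOne k A)
    (WithConv.toConv (convExpPoly he φ hφ)) (WithConv.toConv (convExpPoly he ψ hψ))
  rw [← key] at this
  exact congrArg WithConv.toConv this

theorem algHom_comp_convPow (g : A →ₐ[k] B) (φ : WithConv (D →ₗ[k] A)) (n : ℕ) :
    (WithConv.toConv (g.toLinearMap ∘ₗ φ.ofConv)) ^ n =
      WithConv.toConv (g.toLinearMap ∘ₗ (φ ^ n).ofConv) := by
  induction n with
  | zero =>
    ext x
    simp [LinearMap.convOne_def]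
  | succ n ih =>
    rw [pow_succ, pow_succ, ih]
    exact (congrArg WithConv.toConv (LinearMap.algHom_comp_convMul_distrib g _ _)).symm

theorem convExp_algHom_comp (he : IsConilpotent k e) (g : A →ₐ[k] B)
    (φ : WithConv (D →ₗ[k] A)) (hφ : φ e = 0)
    (h : (WithConv.toConv (g.toLinearMap ∘ₗ φ.ofConv)) e = 0) (x : D) :
    convExp he (WithConv.toConv (g.toLinearMap ∘ₗ φ.ofConv)) h x = g (convExp he φ hφ x) := by
  have key : convExpPoly he (WithConv.toConv (g.toLinearMap ∘ₗ φ.ofConv)) h x =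
      Polynomial.map (g : A →+* B) (convExpPoly he φ hφ x) := by
    ext n
    rw [coeff_convExpPoly, coeff_map, coeff_convExpPoly, algHom_comp_convPow]
    exact (map_smul g _ _).symm
  change aeval (1 : B) (convExpPoly he _ h x) = g (aeval (1 : A) (convExpPoly he φ hφ x))
  rw [key, coe_aeval_eq_eval, coe_aeval_eq_eval, Polynomial.eval_map, ← map_one (g : A →+* B),
    Polynomial.eval₂_at_apply]
  rfl

theorem convExp_of_mul_self_eq_zero (he : IsConilpotent k e) (φ : WithConv (D →ₗ[k] A))
    (hφ : φ e = 0) (h : φ * φ = 0) : convExp he φ hφ = 1 + φ := by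
  ext x
  have key : convExpPoly he φ hφ x =
      Polynomial.C ((1 : WithConv (D →ₗ[k] A)) x) + Polynomial.C (φ x) * Polynomial.X := by
    ext n
    rw [coeff_convExpPoly]
    rcases n with _ | _ | n
    · simp
    · simp
    · rw [add_assoc, pow_add, one_add_one_eq_two, pow_two, h, mul_zero]
      simp [coeff_C, coeff_X]
  change aeval (1 : A) (convExpPoly he _ hφ x) = _
  rw [key]
  simp

end ConvExp

/-! ### Cofreeness of the symmetric coalgebra -/

section Cofree

variable {k : Type u} [Field k] [CharZero k] {V : Type u} [AddCommGroup V] [Module k V]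
  {D : Type u} [AddCommGroup D] [Module k D] [Coalgebra k D] {e : D}

/-- If `F` and `G` agree on `Fₙ`, their difference on `Fₙ₊₁` takes primitive values. In
characteristic zero these lie in `V`, where the projection is injective. -/
theorem symLift_unique (he : IsConilpotent k e) (F G : D →ₗc[k] SymmetricAlgebra k V)
    (h : ∀ x, symProj k V (F x) = symProj k V (G x)) : F = G := by
  have hF : F e = 1 := (isConilpotent_sym k V).eq_of_isGroupLike (he.isGroupLike.map F)
  have hG : G e = 1 := (isConilpotent_sym k V).eq_of_isGroupLike (he.isGroupLike.map G)
  have key : ∀ n, ∀ x ∈ primFiltration k e n, F x = G x := by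
    intro n
    induction n with
    | zero =>
      intro x hx
      obtain ⟨c, rfl⟩ := Submodule.mem_span_singleton.1 hx
      rw [map_smul, map_smul, hF, hG]
    | succ n ih =>
      intro x hx
      have hred : reducedComul k (1 : SymmetricAlgebra k V) (F x) = reducedComul k 1 (G x) := by
        rw [← hF, ← map_reducedComul, hF, ← hG, ← map_reducedComul]
        refine (range_map_le k _ (LinearMap.eqLocus _ _) ?_ hx)
        intro a ha b hb
        rw [LinearMap.mem_eqLocus, TensorProduct.map_tmul, TensorProduct.map_tmul]
        exact congrArg₂ _ (ih a ha) (ih b hb)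
      have hprim : F x - G x ∈ primitives k (1 : SymmetricAlgebra k V) := by
        rw [primitives, LinearMap.mem_ker, map_sub, hred, sub_self]
      obtain ⟨v, hv⟩ := primitives_sym_le k V hprim
      have hv0 : v = 0 := by
        rw [← symProj_ι k V v, hv, map_sub, h, sub_self]
      rw [hv0, map_zero] at hv
      exact sub_eq_zero.1 hv.symm
  refine DFunLike.ext _ _ fun x => ?_
  obtain ⟨n, hn⟩ := he.exhaustive x
  exact key n x hn

/-- The lift is `F = exp(ι ∘ φ)` for convolution. Algebra maps out of `Sym(V)` commute with the
exponential, so the counit, the comultiplication and the projection of `F` are computed by applying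
an algebra map to `ι ∘ φ`. -/
theorem exists_symLift [Coalgebra.IsCocomm k D] (he : IsConilpotent k e) (φ : D →ₗ[k] V)
    (hφ : φ e = 0) :
    ∃ F : D →ₗc[k] SymmetricAlgebra k V, ∀ x, symProj k V (F x) = φ x := by
  let φ₁ : WithConv (D →ₗ[k] SymmetricAlgebra k V) :=
    WithConv.toConv (SymmetricAlgebra.ι k V ∘ₗ φ)
  have hφ₁ : φ₁ e = 0 := by
    change SymmetricAlgebra.ι k V (φ e) = 0
    rw [hφ, map_zero]
  let F := convExp he φ₁ hφ₁
  have comp0 : ∀ {B : Type u} [CommRing B] [Algebra k B] (g : SymmetricAlgebra k V →ₐ[k] B),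
      (WithConv.toConv (g.toLinearMap ∘ₗ φ₁.ofConv)) e = 0 := fun g => by
    change g (φ₁ e) = 0
    rw [hφ₁, map_zero]
  have hcounit : ∀ x, Coalgebra.counit (R := k) (F x) = Coalgebra.counit (R := k) x := by
    intro x
    have h1 := convExp_algHom_comp he (Bialgebra.counitAlgHom k (SymmetricAlgebra k V)) φ₁ hφ₁
      (comp0 _) x
    -- The counit kills `V`, and the exponential of `0` is the convolution unit, that is, the counit
    -- of `D`.
    have h0 : WithConv.toConv ((Bialgebra.counitAlgHom k (SymmetricAlgebra k V)).toLinearMap ∘ₗ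
        φ₁.ofConv) = 0 := by
      ext y
      exact SymmetricAlgebra.algebraMapInv_ι _
    rw [convExp_of_mul_self_eq_zero _ _ _ (by rw [h0, mul_zero]), h0, add_zero] at h1
    exact h1.symm
  have hcomul : ∀ x, TensorProduct.map F.ofConv F.ofConv (Coalgebra.comul (R := k) x) =
      Coalgebra.comul (R := k) (F x) := by
    intro x
    let i₁ : SymmetricAlgebra k V →ₐ[k] SymmetricAlgebra k V ⊗[k] SymmetricAlgebra k V :=
      Algebra.TensorProduct.includeLeft
    let i₂ : SymmetricAlgebra k V →ₐ[k] SymmetricAlgebra k V ⊗[k] SymmetricAlgebra k V :=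
      Algebra.TensorProduct.includeRight
    have h1 := convExp_algHom_comp he (Bialgebra.comulAlgHom k (SymmetricAlgebra k V)) φ₁ hφ₁
      (comp0 _) x
    -- As `Δ v = v ⊗ 1 + 1 ⊗ v`, the exponential turns this sum into the product of `F ⊗ 1` and `1 ⊗
    -- F`, which is `(F ⊗ F) ∘ Δ`.
    have h2 : WithConv.toConv ((Bialgebra.comulAlgHom k (SymmetricAlgebra k V)).toLinearMap ∘ₗ
        φ₁.ofConv) = WithConv.toConv (i₁.toLinearMap ∘ₗ φ₁.ofConv) +
          WithConv.toConv (i₂.toLinearMap ∘ₗ φ₁.ofConv) := by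
      ext y
      simp [φ₁, i₁, i₂]
    have h3 : convExp he _ (comp0 (Bialgebra.comulAlgHom k (SymmetricAlgebra k V))) =
        convExp he _ (comp0 i₁) * convExp he _ (comp0 i₂) := by
      rw [← convExp_add he _ _ _ _ (by rw [← h2]; exact comp0 _)]
      congr 1
    rw [h3] at h1
    refine Eq.trans ?_ h1
    rw [LinearMap.convMul_apply]
    have e₁ : (convExp he _ (comp0 i₁)).ofConv = i₁.toLinearMap ∘ₗ F.ofConv :=
      LinearMap.ext fun y => convExp_algHom_comp he i₁ φ₁ hφ₁ (comp0 i₁) y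
    have e₂ : (convExp he _ (comp0 i₂)).ofConv = i₂.toLinearMap ∘ₗ F.ofConv :=
      LinearMap.ext fun y => convExp_algHom_comp he i₂ φ₁ hφ₁ (comp0 i₂) y
    rw [e₁, e₂]
    generalize Coalgebra.comul (R := k) x = t
    induction t with
    | zero => simp
    | add a b ha hb => simp only [map_add, ha, hb]
    | tmul a b => simp [i₁, i₂]
  refine ⟨{ F.ofConv with
    counit_comp := LinearMap.ext hcounit
    map_comp_comul := LinearMap.ext hcomul }, fun x => ?_⟩
  let : Module kᵐᵒᵖ V := Module.compHom _ ((RingHom.id k).fromOpposite mul_comm)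
  have : IsCentralScalar k V := ⟨fun r m => rfl⟩
  -- In the square-zero extension `k ⊕ V` the exponential stops after its linear term, which is `φ`.
  let g : SymmetricAlgebra k V →ₐ[k] TrivSqZeroExt k V :=
    SymmetricAlgebra.lift (TrivSqZeroExt.inrHom k V)
  have h1 := convExp_algHom_comp he g φ₁ hφ₁ (comp0 g) x
  have hg : ∀ y, g (φ₁ y) = TrivSqZeroExt.inr (φ y) := by
    intro y
    simp [g, φ₁]
  rw [convExp_of_mul_self_eq_zero] at h1
  · change TrivSqZeroExt.snd (g (F x)) = φ x
    rw [← h1]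
    change TrivSqZeroExt.snd (algebraMap k (TrivSqZeroExt k V) (Coalgebra.counit (R := k) x) +
      g (φ₁ x)) = φ x
    rw [hg]
    simp [TrivSqZeroExt.algebraMap_eq_inl]
  · ext y : 2
    rw [(Coalgebra.Repr.arbitrary k y).convMul_apply]
    refine Finset.sum_eq_zero fun i _ => ?_
    change g (φ₁ _) * g (φ₁ _) = 0
    rw [hg, hg, TrivSqZeroExt.inr_mul_inr]

theorem isCofree_symCo [Module.Finite k V] : IsCofree (symCo k V) (symCo.proj k V) where
  map_pt := symProj_one k V
  existsUnique_lift D _ _ _ _ d hd φ hφ := by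
    obtain ⟨F, hF⟩ := exists_symLift hd φ hφ
    refine ⟨F, LinearMap.ext hF, fun G hG => ?_⟩
    exact symLift_unique hd G F fun x => (LinearMap.congr_fun hG x).trans (hF x).symm

end Cofree

/-! ### Ideals of the dual algebra -/

/-- The contraction `x ↦ g(x₁) x₂`. -/
def contraction {k C : Type u} [Field k] [AddCommGroup C] [Module k C] [Coalgebra k C]
    (g : WithConv (C →ₗ[k] k)) : C →ₗ[k] C :=
  (TensorProduct.lid k C).toLinearMap ∘ₗ g.ofConv.rTensor C ∘ₗ Coalgebra.comul

theorem apply_contraction {k C : Type u} [Field k] [AddCommGroup C] [Module k C] [Coalgebra k C]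
    (g h : WithConv (C →ₗ[k] k)) (x : C) : h (contraction g x) = (g * h) x := by
  rw [LinearMap.convMul_apply, contraction, LinearMap.comp_apply, LinearMap.comp_apply]
  generalize Coalgebra.comul (R := k) x = t
  induction t with
  | zero => simp
  | add a b ha hb => simp only [map_add, ha, hb]
  | tmul a b => simp

section DualIdeal

variable {k C : Type u} [Field k] [AddCommGroup C] [Module k C] [Coalgebra k C]
  [Coalgebra.IsCocomm k C]

/-- The elements killed by all functionals of an ideal of the dual algebra. -/
def coannihilator (I : Ideal (WithConv (C →ₗ[k] k))) : Submodule k C where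
  carrier := {x | ∀ f ∈ I, f x = 0}
  add_mem' {x y} hx hy f hf := by rw [map_add, hx f hf, hy f hf, add_zero]
  zero_mem' f _ := map_zero f.ofConv
  smul_mem' c x hx f hf := by rw [map_smul, hx f hf, smul_zero]

/-- As `I` absorbs products on both sides, `Δ x` is killed by `φ ⊗ ψ` as soon as one factor lies in
`I`. -/
theorem isSubcoalgebra_coannihilator (I : Ideal (WithConv (C →ₗ[k] k))) :
    IsSubcoalgebra k (coannihilator I) := by
  intro x hx
  refine mem_range_map_of_forall _ {φ | WithConv.toConv φ ∈ I} ?_ _ ?_ ?_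
  · exact fun y hy f hf => hy f.ofConv hf
  · exact fun φ hφ ψ => hx _ (I.mul_mem_right (WithConv.toConv ψ) hφ)
  · exact fun φ hφ ψ => hx _ (I.mul_mem_left (WithConv.toConv ψ) hφ)

/-- Finitely generated ideals of the dual algebra are closed. -/
theorem mem_of_forall_coannihilator {I : Ideal (WithConv (C →ₗ[k] k))} (hI : I.FG)
    (f : WithConv (C →ₗ[k] k)) (hf : ∀ x ∈ coannihilator I, f x = 0) : f ∈ I := by
  classical
  obtain ⟨s, rfl⟩ := hI
  -- Contractions with the generators detect the coannihilator: a functional vanishing on `ker T`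
  -- factors through `T`, and a factorization `f = h ∘ T` reads `f = ∑ g * h_g`.
  let T : C →ₗ[k] (s → C) := LinearMap.pi fun g => contraction (g : WithConv (C →ₗ[k] k))
  have hT : f.ofConv ∈ (LinearMap.ker T).dualAnnihilator := by
    rw [Submodule.mem_dualAnnihilator]
    refine fun x hx => hf x fun φ hφ => ?_
    have hx' : ∀ g ∈ s, contraction g x = 0 := fun g hg => congrFun hx ⟨g, hg⟩
    -- The claim is strengthened to all products `φ * h`, so that the induction passes through ideal
    -- multiples.
    rw [← mul_one φ]
    generalize (1 : WithConv (C →ₗ[k] k)) = h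
    induction hφ using Submodule.span_induction generalizing h with
    | mem g hg => rw [← apply_contraction, hx' g hg, map_zero]
    | zero => rw [zero_mul]; rfl
    | add a b _ _ ha hb =>
      rw [add_mul]
      change (a * h) x + (b * h) x = 0
      rw [ha, hb, add_zero]
    | smul a b _ hb => rw [smul_eq_mul, mul_assoc, mul_left_comm]; exact hb _
  rw [← LinearMap.range_dualMap_eq_dualAnnihilator_ker] at hT
  obtain ⟨h, hh⟩ := hT
  have : f = ∑ g : s, (g : WithConv (C →ₗ[k] k)) *
      WithConv.toConv (h ∘ₗ LinearMap.single k (fun _ : s => C) g) := by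
    ext x
    rw [← hh, WithConv.ofConv_sum, LinearMap.sum_apply, LinearMap.dualMap_apply,
      ← LinearMap.sum_single_apply (fun _ => C) (T x), map_sum]
    exact Finset.sum_congr rfl fun g _ => apply_contraction (g : WithConv (C →ₗ[k] k))
      (WithConv.toConv (h ∘ₗ LinearMap.single k (fun _ : s => C) g)) x
  rw [this]
  exact Ideal.sum_mem _ fun g _ => Ideal.mul_mem_right _ _ (Ideal.subset_span g.2)

variable {e : C}

/-- Together with `apply_eq_zero_of_mem_pow`, this compares the powers of the augmentation ideal
with the primitive filtration. -/
theorem mem_primFiltration_of_mem_coannihilator (he : IsGroupLikeElem k e)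
    (I : Ideal (WithConv (C →ₗ[k] k))) (hI : ∀ f, f ∈ I ↔ f e = 0) (n : ℕ) :
    coannihilator (I ^ (n + 1)) ≤ primFiltration k e n := by
  induction n with
  | zero =>
    intro x hx
    by_contra h
    obtain ⟨f, hf, hF⟩ := Submodule.exists_le_ker_of_notMem h
    have h1 : WithConv.toConv f ∈ I ^ (0 + 1) := by
      rw [zero_add, pow_one, hI]
      exact hF (Submodule.mem_span_singleton_self e)
    exact hf (hx _ h1)
  | succ n ih =>
    intro x hx
    -- Subtracting its value at `e` puts `ψ` in `I`, so the product with `φ` lies in `I ^ (n + 2)`.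
    -- Since `φ e = 0`, the expression is `φ ⊗ ψ` on the reduced comultiplication of `x`.
    have key : ∀ φ ∈ I ^ (n + 1), ∀ ψ : WithConv (C →ₗ[k] k),
        (φ * ψ) x - φ x * ψ e = 0 := by
      intro φ hφ ψ
      have h1 : ψ - ψ e • 1 ∈ I := (hI _).2 (by simp [he.counit_eq_one])
      have := hx _ (Ideal.mul_mem_mul hφ h1)
      rw [mul_sub, mul_smul_comm, mul_one] at this
      rw [← this]
      simp [mul_comm]
    have hφe : ∀ φ ∈ I ^ (n + 1), φ e = 0 := fun φ hφ =>
      (hI φ).1 (Ideal.pow_le_self n.succ_ne_zero hφ)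
    refine mem_range_map_of_forall _ {φ | WithConv.toConv φ ∈ I ^ (n + 1)} ?_ _ ?_ ?_
    · exact fun y hy => ih fun f hf => hy f.ofConv hf
    · intro φ hφ ψ
      have h1 : φ e = 0 := hφe _ hφ
      rw [← key _ hφ (WithConv.toConv ψ), reducedComul_apply, LinearMap.convMul_apply]
      simp [h1]
    · intro φ hφ ψ
      have h1 : φ e = 0 := hφe _ hφ
      rw [← key _ hφ (WithConv.toConv ψ), reducedComul_apply, mul_comm, LinearMap.convMul_apply]
      simp [h1, mul_comm]

theorem apply_eq_zero_of_mem_pow (he : IsGroupLikeElem k e)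
    (I : Ideal (WithConv (C →ₗ[k] k))) (hI : ∀ f, f ∈ I ↔ f e = 0) (n : ℕ) :
    ∀ f ∈ I ^ 2 ^ n, ∀ x ∈ primFiltration k e n, f x = 0 := by
  induction n with
  | zero =>
    intro f hf x hx
    rw [pow_zero, pow_one, hI] at hf
    obtain ⟨c, rfl⟩ := Submodule.mem_span_singleton.1 hx
    rw [map_smul, hf, smul_zero]
  | succ n ih =>
    intro f hf
    rw [pow_succ, mul_two, pow_add] at hf
    refine Submodule.mul_induction_on hf (fun a ha b hb => ?_) (fun a b ha hb x hx => ?_)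
    · exact convMul_apply_eq_zero he n a b (ih a ha) (ih b hb)
    · change a x + b x = 0
      rw [ha x hx, hb x hx, add_zero]

end DualIdeal

/-! ### The dual algebra of an object -/

section FunAlg

variable {k : Type u} [Field k] {C D : CoCom k}

@[simp] theorem FunAlg.map_apply (f : C ⟶ D) (φ : FunAlg D) (x : C.carrier) :
    (FunAlg.map f φ) x = φ (f.hom x) := rfl

theorem FunAlg.mem_maxIdeal {φ : FunAlg C} : φ ∈ FunAlg.maxIdeal C ↔ φ C.pt = 0 := Iff.rfl

theorem FunAlg.map_algebraMap (f : C ⟶ D) (c : k) :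
    FunAlg.map f (algebraMap k (FunAlg D) c) = algebraMap k (FunAlg C) c := by
  ext x
  rw [FunAlg.map_apply, LinearMap.convAlgebraMap_apply, LinearMap.convAlgebraMap_apply,
    CoalgHomClass.counit_comp_apply]

theorem FunAlg.map_injective {f g : C ⟶ D} (h : FunAlg.map f = FunAlg.map g) : f = g := by
  refine CoCom.hom_ext fun x => ?_
  rw [← sub_eq_zero, ← Module.forall_dual_apply_eq_zero_iff k]
  intro φ
  have := congrArg (fun F => (F (WithConv.toConv φ)) x) h
  rw [map_sub]
  exact sub_eq_zero.2 this

theorem FunAlg.map_comp {E : CoCom k} (f : C ⟶ D) (g : D ⟶ E) :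
    FunAlg.map (f ≫ g) = (FunAlg.map f).comp (FunAlg.map g) := rfl

theorem FunAlg.map_surjective {f : C ⟶ D} (hf : Function.Injective f.hom) :
    Function.Surjective (FunAlg.map f) := by
  intro φ
  obtain ⟨r, hr⟩ := (f.hom : C.carrier →ₗ[k] D.carrier).exists_leftInverse_of_injective
    (LinearMap.ker_eq_bot.2 hf)
  refine ⟨WithConv.toConv (φ.ofConv ∘ₗ r), ?_⟩
  ext x
  exact congrArg φ (LinearMap.congr_fun hr x)

theorem FunAlg.injective_of_map_surjective {f : C ⟶ D}
    (h : Function.Surjective (FunAlg.map f)) : Function.Injective f.hom := by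
  rw [injective_iff_map_eq_zero]
  intro x hx
  rw [← Module.forall_dual_apply_eq_zero_iff k]
  intro φ
  obtain ⟨ψ, hψ⟩ := h (WithConv.toConv φ)
  have : φ x = (FunAlg.map f ψ) x := by rw [hψ]
  rw [this, FunAlg.map_apply, hx, map_zero]

theorem FunAlg.map_mem_maxIdeal (f : C ⟶ D) {φ : FunAlg D} (h : φ ∈ FunAlg.maxIdeal D) :
    FunAlg.map f φ ∈ FunAlg.maxIdeal C := by
  rw [FunAlg.mem_maxIdeal] at h ⊢
  rw [FunAlg.map_apply, CoCom.Hom.map_pt, h]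

theorem FunAlg.map_pow_le (f : C ⟶ D) (n : ℕ) :
    FunAlg.maxIdeal D ^ n ≤ (FunAlg.maxIdeal C ^ n).comap (FunAlg.map f) :=
  (Ideal.pow_right_mono (fun _ h => FunAlg.map_mem_maxIdeal f h) n).trans
    (Ideal.le_comap_pow _ n)

theorem FunAlg.exists_maxIdeal_pow_eq_bot (C : CoCom k) [Module.Finite k C.carrier] :
    ∃ n, FunAlg.maxIdeal C ^ n = ⊥ := by
  obtain ⟨s, hs⟩ := Module.Finite.fg_top (R := k) (M := C.carrier)
  choose N hN using C.isConilpotent.exhaustive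
  have htop : ∀ x, x ∈ primFiltration k C.pt (s.sup N) := by
    intro x
    have : Submodule.span k (s : Set C.carrier) ≤ primFiltration k C.pt (s.sup N) :=
      Submodule.span_le.2 fun y hy =>
        primFiltration_mono C.isConilpotent.isGroupLike (Finset.le_sup (f := N) hy) (hN y)
    exact this (hs ▸ Submodule.mem_top)
  refine ⟨2 ^ s.sup N, ?_⟩
  rw [eq_bot_iff]
  intro f hf
  rw [Ideal.mem_bot]
  ext x
  exact apply_eq_zero_of_mem_pow C.isConilpotent.isGroupLike _ (fun _ => Iff.rfl) _ f hf x
    (htop x)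

theorem counit_prim {x : C.carrier} (hx : x ∈ Prim C) : Coalgebra.counit (R := k) x = 0 := by
  have h1 := Coalgebra.rTensor_counit_comul (R := k) x
  rw [mem_primitives.1 hx, map_add, LinearMap.rTensor_tmul, LinearMap.rTensor_tmul,
    C.isConilpotent.isGroupLike.counit_eq_one, add_eq_right] at h1
  have h2 := congrArg (TensorProduct.lid k _) h1
  rw [TensorProduct.lid_tmul, map_zero] at h2
  have h3 := congrArg (Coalgebra.counit (R := k)) h2
  rwa [map_smul, C.isConilpotent.isGroupLike.counit_eq_one, map_zero, smul_eq_mul, mul_one] at h3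

/-- A linear map on the primitives extends to the coalgebra with value `0` at the base point. -/
theorem exists_extend_prim {K : Type u} [AddCommGroup K] [Module k K] (ℓ : Prim C →ₗ[k] K) :
    ∃ ℓ' : C.carrier →ₗ[k] K, (∀ x : Prim C, ℓ' x = ℓ x) ∧ ℓ' C.pt = 0 := by
  obtain ⟨g, hg⟩ := LinearMap.exists_extend ℓ
  refine ⟨g - (Coalgebra.counit (R := k)).smulRight (g C.pt), fun x => ?_, ?_⟩
  · have := LinearMap.congr_fun hg x
    simp only [LinearMap.sub_apply, LinearMap.smulRight_apply, counit_prim x.2, zero_smul,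
      sub_zero]
    exact this
  · simp [C.isConilpotent.isGroupLike.counit_eq_one]

/-- Generators are extensions of the coordinates on `Prim C`. Their common zero locus, the
coannihilator of the ideal they generate, is a subcoalgebra without nonzero primitives, hence the
line through the base point. As finitely generated ideals are closed, nothing in the maximal ideal
is missed. -/
theorem FunAlg.maxIdeal_fg (C : CoCom k) : (FunAlg.maxIdeal C).FG := by
  have := C.finiteType
  let b := Module.finBasis k (Prim C)
  choose x hx hx0 using fun i => exists_extend_prim (b.coord i)
  let g : Fin (Module.finrank k (Prim C)) → FunAlg C := fun i => WithConv.toConv (x i)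
  have hle : Ideal.span (Set.range g) ≤ FunAlg.maxIdeal C := by
    rw [Ideal.span_le]
    rintro _ ⟨i, rfl⟩
    exact hx0 i
  have hfg : (Ideal.span (Set.range g)).FG := Submodule.fg_span (Set.finite_range g)
  suffices h : FunAlg.maxIdeal C ≤ Ideal.span (Set.range g) by
    rwa [le_antisymm h hle]
  intro f hf
  refine mem_of_forall_coannihilator hfg f fun y hy => ?_
  let W := coannihilator (Ideal.span (Set.range g))
  have hW : IsSubcoalgebra k W := isSubcoalgebra_coannihilator _
  have hpt : C.pt ∈ W := fun f hf => hle hf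
  have hinj : Function.Injective (C.sub W hW hpt).counit.hom := by
    refine CoCom.injective_of_prim (fun p q _ => ?_)
    have h0 : ∀ p : Prim (C.sub W hW hpt), p = 0 := by
      intro p
      apply CoCom.prim_map_injective (C.subι_injective W hW hpt)
      rw [map_zero]
      apply b.ext_elem
      intro i
      rw [map_zero, Finsupp.zero_apply, ← Module.Basis.coord_apply, ← hx]
      exact C.subι_mem W hW hpt p.1 (g i) (Ideal.subset_span ⟨i, rfl⟩)
    rw [h0 p, h0 q]
  obtain ⟨z, rfl⟩ := C.mem_range_subι W hW hpt hy
  have hz : z = (Coalgebra.counit (R := k) z) • (C.sub W hW hpt).pt := by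
    apply hinj
    rw [map_smul, CoCom.Hom.map_pt]
    exact (mul_one (M := k) _).symm
  rw [hz, map_smul, CoCom.Hom.map_pt, map_smul, FunAlg.mem_maxIdeal.1 hf, smul_zero]

/-- The powers of the maximal ideal are open for the topology defined by the finite-dimensional
subspaces. -/
theorem FunAlg.exists_finite_forall_mem_pow (C : CoCom k) (n : ℕ) :
    ∃ E : Submodule k C.carrier, Module.Finite k E ∧
      ∀ φ : FunAlg C, (∀ x ∈ E, φ x = 0) → φ ∈ FunAlg.maxIdeal C ^ n := by
  have := C.finiteType
  -- The exponent `n + 1` places this subspace inside `Fₙ`, which is finite-dimensional.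
  refine ⟨coannihilator (FunAlg.maxIdeal C ^ (n + 1)), ?_, fun φ hφ => ?_⟩
  · have := finite_primFiltration (k := k) (e := C.pt) n
    exact Submodule.finiteDimensional_of_le (mem_primFiltration_of_mem_coannihilator
      C.isConilpotent.isGroupLike _ (fun _ => Iff.rfl) n)
  · exact Ideal.pow_le_pow_right n.le_succ
      (mem_of_forall_coannihilator ((FunAlg.maxIdeal_fg C).pow) φ hφ)

/-- Continuous algebra morphisms between the dual algebras come from coalgebra morphisms. -/
theorem FunAlg.exists_map_eq (γ : FunAlg C →+* FunAlg D)
    (hk : ∀ c, γ (algebraMap k (FunAlg C) c) = algebraMap k (FunAlg D) c)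
    (hγ : ∃ n, FunAlg.maxIdeal C ^ n ≤ RingHom.ker γ) : ∃ w : D ⟶ C, FunAlg.map w = γ := by
  obtain ⟨n, hn⟩ := hγ
  obtain ⟨E, hE, hE'⟩ := FunAlg.exists_finite_forall_mem_pow C n
  let γ' : FunAlg C →ₐ[k] FunAlg D := { γ with commutes' := hk }
  have hvan : ∀ φ : FunAlg C, (∀ x ∈ E, φ x = 0) → γ φ = 0 := fun φ hφ => hn (hE' φ hφ)
  obtain ⟨p, hp⟩ := exists_projection E
  -- By continuity `γ` factors through the dual of `E`; transposing and using `E** = E` gives a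
  -- linear map `D → E ⊆ C` whose dual is `γ`.
  let L : D.carrier →ₗ[k] Module.Dual k (Module.Dual k E) :=
    LinearMap.flip ((WithConv.linearEquiv k _).toLinearMap ∘ₗ γ'.toLinearMap ∘ₗ
      (WithConv.linearEquiv k _).symm.toLinearMap ∘ₗ p.dualMap)
  let w : D.carrier →ₗ[k] C.carrier :=
    E.subtype ∘ₗ (Module.evalEquiv k E).symm.toLinearMap ∘ₗ L
  have hw : ∀ (φ : FunAlg C) x, φ (w x) = (γ φ) x := by
    intro φ x
    have h1 : φ (w x) = Module.evalEquiv k E ((Module.evalEquiv k E).symm (L x))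
        (φ.ofConv ∘ₗ E.subtype) := rfl
    rw [h1, LinearEquiv.apply_symm_apply]
    have h2 : L x (φ.ofConv ∘ₗ E.subtype) =
      (γ (WithConv.toConv ((φ.ofConv ∘ₗ E.subtype) ∘ₗ p))) x := rfl
    rw [h2, ← sub_eq_zero]
    have h3 := hvan (WithConv.toConv ((φ.ofConv ∘ₗ E.subtype) ∘ₗ p) - φ) (by
      intro y hy
      have : p y = ⟨y, hy⟩ := LinearMap.congr_fun hp ⟨y, hy⟩
      change φ (p y) - φ y = 0
      rw [this, sub_self])
    rw [map_sub] at h3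
    exact congrArg (fun ψ : FunAlg D => ψ x) h3
  clear_value w
  refine ⟨⟨{ w with counit_comp := ?_, map_comp_comul := ?_ }⟩, ?_⟩
  · ext x
    have := hw 1 x
    rw [map_one] at this
    exact this
  · ext x
    refine tensor_ext_of_forall fun φ ψ => ?_
    have h1 := hw (WithConv.toConv φ * WithConv.toConv ψ) x
    rw [map_mul, LinearMap.convMul_apply, LinearMap.convMul_apply] at h1
    refine Eq.trans ?_ h1.symm
    have e₁ : (γ (WithConv.toConv φ)).ofConv = φ ∘ₗ w :=
      LinearMap.ext fun y => (hw (WithConv.toConv φ) y).symm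
    have e₂ : (γ (WithConv.toConv ψ)).ofConv = ψ ∘ₗ w :=
      LinearMap.ext fun y => (hw (WithConv.toConv ψ) y).symm
    change LinearMap.mul' k k (TensorProduct.map φ ψ
      (TensorProduct.map w w (Coalgebra.comul (R := k) x))) = _
    rw [e₁, e₂, TensorProduct.map_comp, LinearMap.comp_apply]
  · ext φ x
    exact hw φ x

end FunAlg

/-! ### The coalgebra dual to a finite-dimensional algebra -/

section DualCoalgebra

open TensorProduct

variable {k B : Type u} [Field k] [CommRing B] [Algebra k B]

theorem mul'_map_eval (t : Module.Dual k B ⊗[k] Module.Dual k B) (a b : B) :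
    LinearMap.mul' k k (TensorProduct.map (Module.Dual.eval k B a) (Module.Dual.eval k B b) t) =
      dualDistrib k B B t (a ⊗ₜ b) := by
  induction t with
  | zero => simp
  | add x y hx hy => simp only [map_add, hx, hy, LinearMap.add_apply]
  | tmul x y => simp

variable [Module.Finite k B]

variable (k B) in
/-- The comultiplication dual to the multiplication of a finite-dimensional algebra. -/
def dualComul : Module.Dual k B →ₗ[k] Module.Dual k B ⊗[k] Module.Dual k B :=
  (dualDistribEquiv k B B).symm.toLinearMap ∘ₗ (LinearMap.mul' k B).dualMap

theorem dualDistrib_dualComul (ξ : Module.Dual k B) (a b : B) :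
    dualDistrib k B B (dualComul k B ξ) (a ⊗ₜ b) = ξ (a * b) := by
  have h : dualDistribEquiv k B B (dualComul k B ξ) = (LinearMap.mul' k B).dualMap ξ :=
    LinearEquiv.apply_symm_apply _ _
  exact LinearMap.congr_fun h (a ⊗ₜ b)

theorem dual_tensor_ext {s t : Module.Dual k B ⊗[k] Module.Dual k B}
    (h : ∀ a b, dualDistrib k B B s (a ⊗ₜ b) = dualDistrib k B B t (a ⊗ₜ b)) : s = t :=
  (dualDistribEquiv k B B).injective (TensorProduct.ext' h)

variable (k B) in
/-- The coalgebra structure on the dual of a finite-dimensional algebra. -/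
@[reducible] def dualCoalgebra : Coalgebra k (Module.Dual k B) where
  comul := dualComul k B
  counit := Module.Dual.eval k B 1
  coassoc := by
    -- Identifying the triple tensor power with the dual of that of `B` turns coassociativity into
    -- associativity of `B`, tested on pure tensors.
    let Θ : Module.Dual k B ⊗[k] (Module.Dual k B ⊗[k] Module.Dual k B) ≃ₗ[k]
        Module.Dual k (B ⊗[k] (B ⊗[k] B)) :=
      (LinearEquiv.lTensor _ (dualDistribEquiv k B B)) ≪≫ₗ dualDistribEquiv k B (B ⊗[k] B)
    have hΘ : ∀ (ξ : Module.Dual k B) t (a : B) s, Θ (ξ ⊗ₜ t) (a ⊗ₜ s) =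
        ξ a * dualDistrib k B B t s := fun ξ t a s => rfl
    have h₁ : ∀ t (a b c : B), Θ ((dualComul k B).lTensor _ t) (a ⊗ₜ (b ⊗ₜ c)) =
        dualDistrib k B B t (a ⊗ₜ (b * c)) := by
      intro t a b c
      induction t with
      | zero => simp
      | add x y hx hy => simp only [map_add, hx, hy, LinearMap.add_apply]
      | tmul x y => rw [LinearMap.lTensor_tmul, hΘ, dualDistrib_dualComul, dualDistrib_apply]
    have h₂ : ∀ t (a b c : B),
        Θ (TensorProduct.assoc k _ _ _ ((dualComul k B).rTensor _ t)) (a ⊗ₜ (b ⊗ₜ c)) =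
        dualDistrib k B B t ((a * b) ⊗ₜ c) := by
      intro t a b c
      induction t with
      | zero => simp
      | add x y hx hy => simp only [map_add, hx, hy, LinearMap.add_apply]
      | tmul x y =>
        rw [LinearMap.rTensor_tmul, dualDistrib_apply, ← dualDistrib_dualComul]
        generalize dualComul k B x = s
        induction s with
        | zero => simp
        | add x y hx hy =>
          simp only [map_add, hx, hy, LinearMap.add_apply, TensorProduct.add_tmul, add_mul]
        | tmul x z =>
          rw [TensorProduct.assoc_tmul, hΘ, dualDistrib_apply, dualDistrib_apply, mul_assoc]
    refine LinearMap.ext fun ξ => Θ.injective (TensorProduct.ext (LinearMap.ext fun a =>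
      TensorProduct.ext' fun b c => ?_))
    change Θ (TensorProduct.assoc k _ _ _ ((dualComul k B).rTensor _ (dualComul k B ξ)))
      (a ⊗ₜ (b ⊗ₜ c)) = Θ ((dualComul k B).lTensor _ (dualComul k B ξ)) (a ⊗ₜ (b ⊗ₜ c))
    rw [h₁, h₂, dualDistrib_dualComul, dualDistrib_dualComul, mul_assoc]
  rTensor_counit_comp_comul := by
    refine LinearMap.ext fun ξ => (TensorProduct.lid k _).injective (LinearMap.ext fun b => ?_)
    have h : ∀ t, (TensorProduct.lid k (Module.Dual k B)
        ((Module.Dual.eval k B 1).rTensor _ t)) b = dualDistrib k B B t (1 ⊗ₜ b) := by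
      intro t
      induction t with
      | zero => simp
      | add x y hx hy => simp only [map_add, hx, hy, LinearMap.add_apply]
      | tmul x y => simp
    rw [LinearMap.comp_apply, h, dualDistrib_dualComul]
    simp
  lTensor_counit_comp_comul := by
    refine LinearMap.ext fun ξ => (TensorProduct.rid k _).injective (LinearMap.ext fun b => ?_)
    have h : ∀ t, (TensorProduct.rid k (Module.Dual k B)
        ((Module.Dual.eval k B 1).lTensor _ t)) b = dualDistrib k B B t (b ⊗ₜ 1) := by
      intro t
      induction t with
      | zero => simp
      | add x y hx hy => simp only [map_add, hx, hy, LinearMap.add_apply]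
      | tmul x y => simp [mul_comm]
    rw [LinearMap.comp_apply, h, dualDistrib_dualComul]
    simp

theorem isCocomm_dualCoalgebra :
    let := dualCoalgebra k B; Coalgebra.IsCocomm k (Module.Dual k B) := by
  let := dualCoalgebra k B
  refine ⟨LinearMap.ext fun ξ => dual_tensor_ext fun a b => ?_⟩
  change dualDistrib k B B (TensorProduct.comm k _ _ (dualComul k B ξ)) (a ⊗ₜ b) =
    dualDistrib k B B (dualComul k B ξ) (a ⊗ₜ b)
  rw [← dualDistrib_apply_comm, TensorProduct.comm_tmul, dualDistrib_dualComul,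
    dualDistrib_dualComul, mul_comm]

/-- The algebra isomorphism of a finite-dimensional algebra with the dual of its dual
coalgebra. -/
def evalDual : letI := dualCoalgebra k B; haveI := isCocomm_dualCoalgebra (k := k) (B := B)
    B ≃ₐ[k] WithConv (Module.Dual k B →ₗ[k] k) :=
  letI := dualCoalgebra k B
  haveI := isCocomm_dualCoalgebra (k := k) (B := B)
  AlgEquiv.ofLinearEquiv
    (Module.evalEquiv k B ≪≫ₗ (WithConv.linearEquiv k (Module.Dual k B →ₗ[k] k)).symm) rfl
    (fun a b => by
      ext ξ
      refine Eq.trans ?_ ((mul'_map_eval (dualComul k B ξ) a b).trans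
        (dualDistrib_dualComul ξ a b)).symm
      rfl)

/-- The coalgebra dual to a finite-dimensional augmented algebra with nilpotent augmentation
ideal. -/
def dualCo (aug : B →ₐ[k] k) (h : IsNilpotent (RingHom.ker aug)) : CoCom k :=
  letI := dualCoalgebra k B
  haveI := isCocomm_dualCoalgebra (k := k) (B := B)
  have hgl : IsGroupLikeElem k (aug.toLinearMap : Module.Dual k B) :=
    ⟨map_one aug, dual_tensor_ext fun a b => by
      refine (dualDistrib_dualComul _ a b).trans ?_
      rw [dualDistrib_apply]
      exact map_mul aug a b⟩
  { carrier := Module.Dual k B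
    pt := aug.toLinearMap
    isConilpotent :=
      { isGroupLike := hgl
        exhaustive := fun x => by
          obtain ⟨n, hn⟩ := h
          let I : Ideal (WithConv (Module.Dual k B →ₗ[k] k)) :=
            (RingHom.ker aug).map (evalDual (k := k) (B := B))
          have hI : ∀ f, f ∈ I ↔ f (aug.toLinearMap) = 0 := by
            intro f
            rw [Ideal.mem_map_iff_of_surjective _ (evalDual (k := k) (B := B)).surjective]
            constructor
            · rintro ⟨b, hb, rfl⟩
              exact hb
            · intro hf
              obtain ⟨b, rfl⟩ := (evalDual (k := k) (B := B)).surjective f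
              exact ⟨b, hf, rfl⟩
          -- Nilpotence of the augmentation ideal makes the coannihilator of `I ^ (n + 1)` the whole
          -- coalgebra.
          refine ⟨n, mem_primFiltration_of_mem_coannihilator hgl I hI n ?_⟩
          intro f hf
          have h0 : I ^ n = ⊥ := by
            rw [← Ideal.map_pow, hn]
            exact Ideal.map_bot
          have hf' := Ideal.pow_le_pow_right n.le_succ hf
          rw [h0, Ideal.mem_bot] at hf'
          rw [hf']
          rfl }
    finiteType := inferInstance }

/-- The algebra isomorphism between an algebra and the functions on its dual coalgebra. -/
def funAlgDualCo (aug : B →ₐ[k] k) (h : IsNilpotent (RingHom.ker aug)) :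
    B ≃ₐ[k] FunAlg (dualCo aug h) := evalDual

instance (aug : B →ₐ[k] k) (h : IsNilpotent (RingHom.ker aug)) :
    Module.Finite k (dualCo aug h).carrier :=
  inferInstanceAs (Module.Finite k (Module.Dual k B))

end DualCoalgebra

/-! ### Augmentations -/

section Augmentation

variable {k B : Type u} [Field k] [CommRing B] [Algebra k B]

/-- Modulo the nilradical every element is a scalar, so the quotient is `k`. The nilradical is
nilpotent because `B` is Noetherian. -/
theorem exists_augmentation [Nontrivial B] [Module.Finite k B]
    (h : ∀ b : B, ∃ c : k, IsNilpotent (b - algebraMap k B c)) :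
    ∃ aug : B →ₐ[k] k, IsNilpotent (RingHom.ker aug) := by
  have hnt : Nontrivial (B ⧸ nilradical B) := Ideal.Quotient.nontrivial_iff.2 fun h1 => by
    have : (1 : B) ∈ nilradical B := by rw [h1]; trivial
    rw [mem_nilradical] at this
    exact not_isNilpotent_one this
  let i : k →ₐ[k] B ⧸ nilradical B := Algebra.ofId k _
  have hi : Function.Bijective i := by
    refine ⟨(i : k →+* B ⧸ nilradical B).injective, fun y => ?_⟩
    obtain ⟨b, rfl⟩ := Ideal.Quotient.mk_surjective y
    obtain ⟨c, hc⟩ := h b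
    refine ⟨c, ?_⟩
    have : Ideal.Quotient.mk (nilradical B) (b - algebraMap k B c) = 0 :=
      Ideal.Quotient.eq_zero_iff_mem.2 (mem_nilradical.2 hc)
    rw [map_sub, sub_eq_zero] at this
    exact this.symm
  let i' := AlgEquiv.ofBijective i hi
  refine ⟨i'.symm.toAlgHom.comp (Ideal.Quotient.mkₐ k (nilradical B)), ?_⟩
  have hker : RingHom.ker (i'.symm.toAlgHom.comp (Ideal.Quotient.mkₐ k (nilradical B))) =
      nilradical B := by
    ext b
    rw [RingHom.mem_ker]
    change i'.symm (Ideal.Quotient.mk (nilradical B) b) = 0 ↔ _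
    rw [EmbeddingLike.map_eq_zero_iff, Ideal.Quotient.eq_zero_iff_mem]
  rw [hker]
  have : IsNoetherianRing B := IsNoetherianRing.of_finite k B
  exact IsNoetherianRing.isNilpotent_nilradical B

end Augmentation

section

/-! ### Formal submersions and lifting properties -/

/-- Formal smoothness allows lifting along nilpotent ideals. -/
theorem IsFormallySmoothAdic.exists_lift {R S : Type u} [CommRing R] [CommRing S] {I : Ideal R}
    {J : Ideal S} {φ : R →+* S} (h : IsFormallySmoothAdic I J φ) {A : Type u} [CommRing A]
    (N : Ideal A) (hN : IsNilpotent N) :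
    ∀ (α : R →+* A) (β : S →+* A ⧸ N),
      (∃ n : ℕ, I ^ n ≤ RingHom.ker α) → (∃ n : ℕ, J ^ n ≤ RingHom.ker β) →
      (Ideal.Quotient.mk N).comp α = β.comp φ →
      ∃ γ : S →+* A, (∃ n : ℕ, J ^ n ≤ RingHom.ker γ) ∧
        γ.comp φ = α ∧ (Ideal.Quotient.mk N).comp γ = β := by
  refine Ideal.IsNilpotent.induction_on (P := fun A _ N => ∀ (α : R →+* A) (β : S →+* A ⧸ N),
      (∃ n : ℕ, I ^ n ≤ RingHom.ker α) → (∃ n : ℕ, J ^ n ≤ RingHom.ker β) →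
      (Ideal.Quotient.mk N).comp α = β.comp φ →
      ∃ γ : S →+* A, (∃ n : ℕ, J ^ n ≤ RingHom.ker γ) ∧
        γ.comp φ = α ∧ (Ideal.Quotient.mk N).comp γ = β) N hN (fun A _ N hN => h A N hN) ?_
  intro A _ N M hNM h₁ h₂ α β ⟨n, hn⟩ ⟨m, hm⟩ hc
  -- For `N ≤ M`, lift from `A / M` to `A / N` along the image of `M`, then from `A / N` to `A`.
  let e := DoubleQuot.quotQuotEquivQuotOfLE hNM
  have he : ∀ a, e (Ideal.Quotient.mk _ (Ideal.Quotient.mk N a)) = Ideal.Quotient.mk M a :=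
    fun a => rfl
  obtain ⟨γ₁, hγ₁, h₁₁, h₁₂⟩ := h₂ ((Ideal.Quotient.mk N).comp α)
    ((e.symm : _ →+* _).comp β)
    ⟨n, fun x hx => by
      have : α x = 0 := hn hx
      rw [RingHom.mem_ker, RingHom.comp_apply, this, map_zero]⟩
    ⟨m, fun x hx => by
      have : β x = 0 := hm hx
      rw [RingHom.mem_ker, RingHom.comp_apply, this, map_zero]⟩
    (by
      ext x
      apply e.injective
      rw [RingHom.comp_apply, RingHom.comp_apply, he]
      refine (RingHom.congr_fun hc x).trans ?_
      exact (e.apply_symm_apply _).symm)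
  obtain ⟨γ, hγ, h₂₁, h₂₂⟩ := h₁ α γ₁ ⟨n, hn⟩ hγ₁ h₁₁.symm
  refine ⟨γ, hγ, h₂₁, ?_⟩
  ext x
  have h3 := RingHom.congr_fun h₁₂ x
  rw [← h₂₂] at h3
  have h4 := congrArg e h3
  rw [RingHom.comp_apply, RingHom.comp_apply, he] at h4
  exact h4.trans (e.apply_symm_apply _)

variable {k : Type u} [Field k]

/-- The injective morphisms with finite-dimensional target. -/
def finiteInjections (k : Type u) [Field k] : MorphismProperty (CoCom k) :=
  fun _ Y i => Function.Injective i.hom ∧ Module.Finite k Y.carrier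

/-- Dualize the square: an injection becomes a surjection whose kernel lies in the maximal ideal of
`k[X]`, which is nilpotent as `X` is finite-dimensional. -/
theorem IsFormalSubmersion.rlp {C D : CoCom k} {f : C ⟶ D} (hf : IsFormalSubmersion f) :
    (finiteInjections k).rlp f := by
  rintro X₀ X i ⟨hi, hX⟩
  refine ⟨fun {u v} sq => ?_⟩
  have hsurj := FunAlg.map_surjective hi
  let N := RingHom.ker (FunAlg.map i)
  have hN : IsNilpotent N := by
    obtain ⟨n, hn⟩ := FunAlg.exists_maxIdeal_pow_eq_bot X
    refine ⟨n, ?_⟩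
    rw [Ideal.zero_eq_bot, eq_bot_iff, ← hn]
    refine Ideal.pow_right_mono (fun φ hφ => ?_) n
    rw [FunAlg.mem_maxIdeal, ← CoCom.Hom.map_pt i, ← FunAlg.map_apply, RingHom.mem_ker.1 hφ]
    rfl
  let e := RingHom.quotientKerEquivOfSurjective hsurj
  have he : ∀ φ, e (Ideal.Quotient.mk N φ) = FunAlg.map i φ := fun φ => rfl
  obtain ⟨n, hn⟩ := FunAlg.exists_maxIdeal_pow_eq_bot X
  have : Module.Finite k X₀.carrier :=
    Module.Finite.of_injective (i.hom : X₀.carrier →ₗ[k] X.carrier) hi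
  obtain ⟨m, hm⟩ := FunAlg.exists_maxIdeal_pow_eq_bot X₀
  obtain ⟨γ, hγ, hγ₁, hγ₂⟩ := IsFormallySmoothAdic.exists_lift hf N hN (FunAlg.map v)
    ((e.symm : _ →+* _).comp (FunAlg.map u))
    ⟨n, fun φ hφ => by
      have := FunAlg.map_pow_le v n hφ
      rwa [hn] at this⟩
    ⟨m, fun φ hφ => by
      have h1 := FunAlg.map_pow_le u m hφ
      rw [hm, Ideal.mem_comap, Ideal.mem_bot] at h1
      rw [RingHom.mem_ker, RingHom.comp_apply, h1, map_zero]⟩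
    (by
      ext1 φ
      apply e.injective
      rw [RingHom.comp_apply, he, ← RingHom.comp_apply, ← FunAlg.map_comp, ← sq.w]
      exact (e.apply_symm_apply _).symm)
  -- The filler is only a ring map, but the scalars of `k[C]` come from `k[D]`, where it is
  -- prescribed.
  obtain ⟨w, hw⟩ := FunAlg.exists_map_eq γ (fun c => by
    rw [← FunAlg.map_algebraMap f, ← RingHom.comp_apply, hγ₁, FunAlg.map_algebraMap]) hγ
  refine ⟨⟨⟨w, FunAlg.map_injective ?_, FunAlg.map_injective ?_⟩⟩⟩
  · rw [FunAlg.map_comp, hw]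
    ext1 φ
    have := congrArg e (RingHom.congr_fun hγ₂ φ)
    rw [RingHom.comp_apply, he] at this
    exact this.trans (e.apply_symm_apply _)
  · rw [FunAlg.map_comp, hw, hγ₁]

theorem FunAlg.finite_range {C : CoCom k} {A : Type u} [CommRing A] [Algebra k A]
    (γ : FunAlg C →ₐ[k] A) (hγ : ∃ n, FunAlg.maxIdeal C ^ n ≤ RingHom.ker γ) :
    Module.Finite k γ.range := by
  obtain ⟨n, hn⟩ := hγ
  obtain ⟨E, hE, hE'⟩ := FunAlg.exists_finite_forall_mem_pow C n
  obtain ⟨p, hp⟩ := exists_projection E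
  let L : Module.Dual k E →ₗ[k] A :=
    γ.toLinearMap ∘ₗ (WithConv.linearEquiv k _).symm.toLinearMap ∘ₗ p.dualMap
  have hle : γ.range.toSubmodule ≤ LinearMap.range L := by
    rintro _ ⟨φ, rfl⟩
    refine ⟨φ.ofConv ∘ₗ E.subtype, ?_⟩
    rw [← sub_eq_zero]
    refine Eq.trans (map_sub γ _ _).symm (hn (hE' _ fun y hy => ?_))
    have : p y = ⟨y, hy⟩ := LinearMap.congr_fun hp ⟨y, hy⟩
    change φ (p y) - φ y = 0
    rw [this, sub_self]
  exact Submodule.finiteDimensional_of_le hle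

theorem FunAlg.exists_isNilpotent_sub {C : CoCom k} {A : Type u} [CommRing A] [Algebra k A]
    (γ : FunAlg C →ₐ[k] A) (hγ : ∃ n, FunAlg.maxIdeal C ^ n ≤ RingHom.ker γ) :
    ∀ a ∈ γ.range, ∃ c : k, IsNilpotent (a - algebraMap k A c) := by
  rintro _ ⟨φ, rfl⟩
  obtain ⟨n, hn⟩ := hγ
  refine ⟨φ C.pt, n, ?_⟩
  have hmem : φ - algebraMap k _ (φ C.pt) ∈ FunAlg.maxIdeal C := by
    rw [FunAlg.mem_maxIdeal, WithConv.ofConv_sub, LinearMap.sub_apply,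
      LinearMap.convAlgebraMap_apply, C.isConilpotent.isGroupLike.counit_eq_one]
    simp
  have := hn (Ideal.pow_mem_pow hmem n)
  rwa [RingHom.mem_ker, map_pow, map_sub, AlgHom.commutes] at this

theorem isNilpotent_of_mk {A : Type u} [CommRing A] {N : Ideal A} (hN : N ^ 2 = ⊥) {a : A}
    (h : IsNilpotent (Ideal.Quotient.mk N a)) : IsNilpotent a := by
  obtain ⟨n, hn⟩ := h
  rw [← map_pow, Ideal.Quotient.eq_zero_iff_mem] at hn
  refine ⟨n * 2, ?_⟩
  rw [pow_mul, ← Ideal.mem_bot, ← hN]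
  exact Ideal.pow_mem_pow hn 2

/-- Enlarge `B₁` by lifts of a finite spanning set of `B₀`. A lift is a scalar plus a nilpotent,
since `N` is nilpotent; so it is integral, and adjoining finitely many keeps the dimension finite.
-/
theorem exists_finite_subalgebra {A : Type u} [CommRing A] [Algebra k A] {N : Ideal A}
    (hN : N ^ 2 = ⊥) (B₁ : Subalgebra k A) [Module.Finite k B₁] (B₀ : Subalgebra k (A ⧸ N))
    [Module.Finite k B₀]
    (h₀ : ∀ b ∈ B₀, ∃ c : k, IsNilpotent (b - algebraMap k (A ⧸ N) c))
    (h : B₁ ≤ B₀.comap (Ideal.Quotient.mkₐ k N)) :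
    ∃ B : Subalgebra k A, B₁ ≤ B ∧ Module.Finite k B ∧ B.map (Ideal.Quotient.mkₐ k N) = B₀ ∧
      ∀ b ∈ B, ∃ c : k, IsNilpotent (b - algebraMap k A c) := by
  have hnil : ∀ a, Ideal.Quotient.mk N a ∈ B₀ →
      ∃ c : k, IsNilpotent (a - algebraMap k A c) := fun a ha => by
    obtain ⟨c, hc⟩ := h₀ _ ha
    refine ⟨c, isNilpotent_of_mk hN ?_⟩
    rw [map_sub]
    exact hc
  obtain ⟨t, ht⟩ := (Module.Finite.iff_fg (N := B₀.toSubmodule)).1 ‹_›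
  choose r hr using Ideal.Quotient.mk_surjective (I := N)
  let s : Set A := r '' t
  have htB : ∀ y ∈ t, y ∈ B₀ := fun y hy => by
    have : y ∈ B₀.toSubmodule := ht ▸ Submodule.subset_span hy
    exact this
  have hs : ∀ a ∈ s, Ideal.Quotient.mk N a ∈ B₀ := by
    rintro _ ⟨y, hy, rfl⟩
    rw [hr]
    exact htB y hy
  have hint : ∀ a ∈ s, IsIntegral k a := fun a ha => by
    obtain ⟨c, n, hn⟩ := hnil a (hs a ha)
    have h1 : IsIntegral k (a - algebraMap k A c) := by
      refine IsIntegral.of_pow n.succ_pos ?_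
      rw [pow_succ, hn, zero_mul]
      exact isIntegral_zero
    simpa using h1.add (isIntegral_algebraMap (x := c))
  have hfin : Module.Finite k (Algebra.adjoin k s) :=
    Module.Finite.iff_fg.2 (fg_adjoin_of_finite ((Finset.finite_toSet t).image r) hint)
  have hle : B₁ ⊔ Algebra.adjoin k s ≤ B₀.comap (Ideal.Quotient.mkₐ k N) :=
    sup_le h (Algebra.adjoin_le hs)
  refine ⟨B₁ ⊔ Algebra.adjoin k s, le_sup_left, Subalgebra.finite_sup _ _,
    le_antisymm (Subalgebra.map_le.2 hle) ?_, fun b hb => hnil b (hle hb)⟩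
  have h1 : B₀.toSubmodule ≤
      ((B₁ ⊔ Algebra.adjoin k s).map (Ideal.Quotient.mkₐ k N)).toSubmodule := by
    rw [← ht, Submodule.span_le]
    intro y hy
    exact ⟨r y, (le_sup_right : _ ≤ B₁ ⊔ _) (Algebra.subset_adjoin ⟨y, hy, rfl⟩), hr y⟩
  exact h1

/-- The test square restricts to a finite-dimensional subalgebra `B` of `A` and its quotient, the
image of `β`. Their dual coalgebras form a lifting problem against `f`, and the dual of a solution
is the filler. -/
theorem isFormalSubmersion_of_rlp {C D : CoCom k} {f : C ⟶ D}
    (hf : (finiteInjections k).rlp f) : IsFormalSubmersion f := by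
  intro A _ N hN α β hα hβ hc
  -- The zero ring has no augmentation, hence no dual coalgebra with a base point.
  rcases subsingleton_or_nontrivial A with hA | hA
  · exact ⟨{ toFun := fun _ => 0, map_one' := Subsingleton.elim _ _,
             map_mul' := fun _ _ => Subsingleton.elim _ _, map_zero' := rfl,
             map_add' := fun _ _ => Subsingleton.elim _ _ },
      ⟨0, fun _ _ => Subsingleton.elim _ _⟩, RingHom.ext fun _ => Subsingleton.elim _ _,
      RingHom.ext fun x => by
        obtain ⟨a, ha⟩ := Ideal.Quotient.mk_surjective (β x)
        rw [← ha, RingHom.comp_apply]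
        exact congrArg _ (Subsingleton.elim _ _)⟩
  -- The test ring is not a `k`-algebra a priori; `α` makes it one, and the square makes `β` linear.
  let : Algebra k A := (α.comp (algebraMap k (FunAlg D))).toAlgebra
  have hN' : Nontrivial (A ⧸ N) := Ideal.Quotient.nontrivial_iff.2 fun h => by
    rw [h, Ideal.top_pow] at hN
    exact top_ne_bot hN
  let α' : FunAlg D →ₐ[k] A := { α with commutes' := fun _ => rfl }
  let β' : FunAlg C →ₐ[k] A ⧸ N :=
    { β with
      commutes' := fun c => by
        have := RingHom.congr_fun hc (algebraMap k _ c)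
        rw [RingHom.comp_apply β, FunAlg.map_algebraMap] at this
        exact this.symm }
  have := FunAlg.finite_range α' hα
  have := FunAlg.finite_range β' hβ
  obtain ⟨B, hB₁, hB, hB₀, hBn⟩ := exists_finite_subalgebra hN α'.range β'.range
    (FunAlg.exists_isNilpotent_sub β' hβ) (by
      rintro _ ⟨φ, rfl⟩
      exact ⟨FunAlg.map f φ, (RingHom.congr_fun hc φ).symm⟩)
  obtain ⟨aug, haug⟩ := exists_augmentation (k := k) (B := B) fun b => by
    obtain ⟨c, hc⟩ := hBn b b.2
    exact ⟨c, (IsNilpotent.map_iff (f := B.val) Subtype.val_injective).1 hc⟩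
  obtain ⟨aug₀, haug₀⟩ := exists_augmentation (k := k) (B := β'.range) fun b => by
    obtain ⟨c, hc⟩ := FunAlg.exists_isNilpotent_sub β' hβ b b.2
    exact ⟨c, (IsNilpotent.map_iff (f := β'.range.val) Subtype.val_injective).1 hc⟩
  let e := funAlgDualCo aug haug
  let e₀ := funAlgDualCo aug₀ haug₀
  let α₁ : FunAlg D →ₐ[k] B := α'.codRestrict B fun φ => hB₁ ⟨φ, rfl⟩
  let q : B →ₐ[k] β'.range := ((Ideal.Quotient.mkₐ k N).comp B.val).codRestrict β'.range
    fun b => by rw [← hB₀]; exact ⟨b, b.2, rfl⟩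
  have hq : Function.Surjective q := by
    rintro ⟨y, hy⟩
    obtain ⟨b, hb, rfl⟩ : y ∈ B.map (Ideal.Quotient.mkₐ k N) := hB₀ ▸ hy
    exact ⟨⟨b, hb⟩, rfl⟩
  let βe : FunAlg C →ₐ[k] FunAlg (dualCo aug₀ haug₀) := e₀.toAlgHom.comp β'.rangeRestrict
  let αe : FunAlg D →ₐ[k] FunAlg (dualCo aug haug) := e.toAlgHom.comp α₁
  let qe : FunAlg (dualCo aug haug) →ₐ[k] FunAlg (dualCo aug₀ haug₀) :=
    e₀.toAlgHom.comp (q.comp e.symm.toAlgHom)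
  obtain ⟨u, hu⟩ := FunAlg.exists_map_eq βe.toRingHom βe.commutes (by
      obtain ⟨n, hn⟩ := hβ
      refine ⟨n, fun φ hφ => ?_⟩
      have h1 : β'.rangeRestrict φ = 0 := Subtype.ext (hn hφ)
      change e₀ (β'.rangeRestrict φ) = 0
      rw [h1, map_zero])
  obtain ⟨v, hv⟩ := FunAlg.exists_map_eq αe.toRingHom αe.commutes (by
      obtain ⟨n, hn⟩ := hα
      refine ⟨n, fun φ hφ => ?_⟩
      have h1 : α₁ φ = 0 := Subtype.ext (hn hφ)
      change e (α₁ φ) = 0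
      rw [h1, map_zero])
  obtain ⟨m, hm⟩ := FunAlg.exists_maxIdeal_pow_eq_bot (dualCo aug haug)
  obtain ⟨i, hi⟩ := FunAlg.exists_map_eq qe.toRingHom qe.commutes ⟨m, hm ▸ bot_le⟩
  have hiinj : Function.Injective i.hom := by
    apply FunAlg.injective_of_map_surjective
    rw [hi]
    exact e₀.surjective.comp (hq.comp e.symm.surjective)
  have sq : CommSq u i f v := ⟨FunAlg.map_injective (by
    rw [FunAlg.map_comp, FunAlg.map_comp, hu, hv, hi]
    ext1 φ
    change e₀ (β'.rangeRestrict (FunAlg.map f φ)) = e₀ (q (e.symm (e (α₁ φ))))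
    rw [e.symm_apply_apply]
    exact congrArg e₀ (Subtype.ext (RingHom.congr_fun hc φ).symm))⟩
  have := hf i ⟨hiinj, inferInstance⟩
  have hw₁ : ∀ φ, FunAlg.map i (FunAlg.map sq.lift φ) = FunAlg.map u φ := fun φ => by
    rw [← RingHom.comp_apply, ← FunAlg.map_comp, sq.fac_left]
  have hw₂ : ∀ φ, FunAlg.map sq.lift (FunAlg.map f φ) = FunAlg.map v φ := fun φ => by
    rw [← RingHom.comp_apply, ← FunAlg.map_comp, sq.fac_right]
  refine ⟨(B.val : B →+* A).comp ((e.symm : FunAlg (dualCo aug haug) →+* B).comp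
    (FunAlg.map sq.lift)), ⟨m, fun φ hφ => ?_⟩, ?_, ?_⟩
  · have h1 := FunAlg.map_pow_le sq.lift m hφ
    rw [hm, Ideal.mem_comap, Ideal.mem_bot] at h1
    rw [RingHom.mem_ker, RingHom.comp_apply, RingHom.comp_apply, h1, map_zero, map_zero]
  · ext φ
    change ((e.symm (FunAlg.map sq.lift (FunAlg.map f φ)) : B) : A) = α φ
    rw [hw₂, hv]
    change ((e.symm (e (α₁ φ)) : B) : A) = α φ
    rw [e.symm_apply_apply]
    rfl
  · ext φ
    have h1 : FunAlg.map i (FunAlg.map sq.lift φ) =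
        e₀ (q (e.symm (FunAlg.map sq.lift φ))) := by rw [hi]; rfl
    have h2 : FunAlg.map u φ = e₀ (β'.rangeRestrict φ) := by rw [hu]; rfl
    rw [hw₁, h2] at h1
    exact (congrArg Subtype.val (e₀.injective h1)).symm

theorem formalSubmersions_eq_rlp : formalSubmersions k = (finiteInjections k).rlp := by
  ext C D f
  exact ⟨IsFormalSubmersion.rlp, isFormalSubmersion_of_rlp⟩

end

section

variable {k : Type u} [Field k]

/-! ### Lifting along arbitrary injections -/

section PartialHom

variable {X C : CoCom k}

/-- The compatibility of a partially defined linear map with the comultiplications at `x`. -/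
def ComulCompatAt (P : X.carrier →ₗ.[k] C.carrier) (x : P.domain) : Prop :=
  ∃ t : P.domain ⊗[k] P.domain,
    TensorProduct.map P.domain.subtype P.domain.subtype t =
      Coalgebra.comul (R := k) (x : X.carrier) ∧
    TensorProduct.map P.toFun P.toFun t = Coalgebra.comul (R := k) (P x)

theorem ComulCompatAt.mono {P Q : X.carrier →ₗ.[k] C.carrier} (h : P ≤ Q) {x : P.domain}
    (hx : ComulCompatAt P x) : ComulCompatAt Q (Submodule.inclusion h.1 x) := by
  obtain ⟨t, h₁, h₂⟩ := hx
  have hQ : Q.toFun ∘ₗ Submodule.inclusion h.1 = P.toFun :=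
    LinearMap.ext fun y => (h.2 (x := y) rfl).symm
  refine ⟨TensorProduct.map (Submodule.inclusion h.1) (Submodule.inclusion h.1) t, ?_, ?_⟩
  · rw [← LinearMap.comp_apply, ← TensorProduct.map_comp, Submodule.subtype_comp_inclusion, h₁]
    rfl
  · rw [← LinearMap.comp_apply, ← TensorProduct.map_comp, hQ, h₂]
    exact congrArg _ (LinearMap.congr_fun hQ x).symm

theorem ComulCompatAt.add {P : X.carrier →ₗ.[k] C.carrier} {x y : P.domain}
    (hx : ComulCompatAt P x) (hy : ComulCompatAt P y) : ComulCompatAt P (x + y) := by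
  obtain ⟨s, h₁, h₂⟩ := hx
  obtain ⟨t, h₃, h₄⟩ := hy
  refine ⟨s + t, ?_, ?_⟩
  · rw [map_add, h₁, h₃, ← map_add]; rfl
  · rw [map_add, h₂, h₄, ← map_add, ← LinearPMap.map_add]

/-- The compatibility witness lives in the tensor square of the domain, so closure of the domain
under `Δ` is built in. -/
theorem ComulCompatAt.isSubcoalgebra {P : X.carrier →ₗ.[k] C.carrier}
    (h : ∀ x, ComulCompatAt P x) : IsSubcoalgebra k P.domain := fun x hx => by
  obtain ⟨t, ht, -⟩ := h ⟨x, hx⟩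
  exact ⟨t, ht⟩

theorem ComulCompatAt.exists_hom {P : X.carrier →ₗ.[k] C.carrier}
    (h : ∀ x, ComulCompatAt P x) (hpt : X.pt ∈ P.domain)
    (hε : ∀ x, Coalgebra.counit (R := k) (P x) = Coalgebra.counit (R := k) (x : X.carrier)) :
    ∃ g : X.sub P.domain (isSubcoalgebra h) hpt ⟶ C, ∀ x : P.domain, g.hom x = P x := by
  refine ⟨CoCom.Hom.mk (C := X.sub P.domain (isSubcoalgebra h) hpt)
    { P.toFun with
      counit_comp := LinearMap.ext hε
      map_comp_comul := LinearMap.ext fun x => ?_ }, fun _ => rfl⟩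
  obtain ⟨t, h₁, h₂⟩ := h x
  refine Eq.trans ?_ h₂
  have h₃ : (subcoalgebra (isSubcoalgebra h)).comul x = t :=
    map_injective_of_injective P.domain.subtype_injective P.domain.subtype_injective
      ((map_comul_subcoalgebra _ x).trans h₁.symm)
  exact congrArg (TensorProduct.map P.toFun P.toFun) h₃

theorem comulCompatAt_of_hom {W : Submodule k X.carrier} {hW : IsSubcoalgebra k W}
    {hpt : X.pt ∈ W} (g : X.sub W hW hpt ⟶ C) (x : W) :
    ComulCompatAt ⟨W, (g.hom : (X.sub W hW hpt).carrier →ₗ[k] C.carrier)⟩ x :=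
  ⟨(subcoalgebra hW).comul x, map_comul_subcoalgebra hW x,
    CoalgHomClass.map_comp_comul_apply (A := (X.sub W hW hpt).carrier) g.hom x⟩

theorem IsSubcoalgebra.inf {W E : Submodule k X.carrier} (hW : IsSubcoalgebra k W)
    (hE : IsSubcoalgebra k E) : IsSubcoalgebra k (W ⊓ E) := by
  intro x hx
  refine mem_range_map_of_forall _ {φ | W ≤ LinearMap.ker φ ∨ E ≤ LinearMap.ker φ} ?_ _ ?_ ?_
  · intro y hy
    refine ⟨?_, ?_⟩ <;> by_contra h <;>
      obtain ⟨f, hf, hF⟩ := Submodule.exists_le_ker_of_notMem h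
    · exact hf (hy f (Or.inl hF))
    · exact hf (hy f (Or.inr hF))
  · rintro φ (hφ | hφ) ψ
    · exact mul'_map_eq_zero_of_mem_range W (Or.inl hφ) (hW x hx.1)
    · exact mul'_map_eq_zero_of_mem_range E (Or.inl hφ) (hE x hx.2)
  · rintro φ (hφ | hφ) ψ
    · exact mul'_map_eq_zero_of_mem_range W (Or.inr hφ) (hW x hx.1)
    · exact mul'_map_eq_zero_of_mem_range E (Or.inr hφ) (hE x hx.2)

variable {D : CoCom k}

/-- Partial lifts of `v` along `f`: partially defined coalgebra morphisms. -/
structure IsPartialLift (f : C ⟶ D) (v : X ⟶ D) (P : X.carrier →ₗ.[k] C.carrier) : Prop where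
  comul : ∀ x, ComulCompatAt P x
  comp : ∀ x : P.domain, f.hom (P x) = v.hom x
  pt_mem : X.pt ∈ P.domain

/-- Compatibility with counits need not be imposed, because `f` and `v` preserve them. -/
theorem IsPartialLift.exists_hom {f : C ⟶ D} {v : X ⟶ D} {P : X.carrier →ₗ.[k] C.carrier}
    (h : IsPartialLift f v P) :
    ∃ g : X.sub P.domain (ComulCompatAt.isSubcoalgebra h.comul) h.pt_mem ⟶ C,
      ∀ x : P.domain, g.hom x = P x :=
  ComulCompatAt.exists_hom h.comul h.pt_mem fun x => by
    rw [← CoalgHomClass.counit_comp_apply f.hom, h.comp, CoalgHomClass.counit_comp_apply]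

/-- The intersection of the domain with `E` is a subcoalgebra, and its inclusion in `E` is a finite
injection. Lift over `E` relative to it, then glue; compatibility on the sum is additive. -/
theorem IsPartialLift.extend {f : C ⟶ D} {v : X ⟶ D} (hf : (finiteInjections k).rlp f)
    {P : X.carrier →ₗ.[k] C.carrier} (h : IsPartialLift f v P) (E : Submodule k X.carrier)
    (hE : IsSubcoalgebra k E) (hEpt : X.pt ∈ E) [Module.Finite k E] :
    ∃ Q, IsPartialLift f v Q ∧ P ≤ Q ∧ E ≤ Q.domain := by
  have hW := ComulCompatAt.isSubcoalgebra h.comul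
  obtain ⟨g, hg⟩ := h.exists_hom
  let W := P.domain ⊓ E
  have hWpt : X.pt ∈ W := ⟨h.pt_mem, hEpt⟩
  let XI := X.sub W (hW.inf hE) hWpt
  obtain ⟨j, hj⟩ := CoCom.exists_factor (X.subι P.domain hW h.pt_mem)
    (X.subι_injective _ _ _) (X.subι W (hW.inf hE) hWpt)
    (fun x => X.mem_range_subι _ _ _ (X.subι_mem _ _ _ x).1)
  obtain ⟨i, hi⟩ := CoCom.exists_factor (X.subι E hE hEpt)
    (X.subι_injective _ _ _) (X.subι W (hW.inf hE) hWpt)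
    (fun x => X.mem_range_subι _ _ _ (X.subι_mem _ _ _ x).2)
  have hj' : ∀ x : W,
      j.hom x = (⟨x, x.2.1⟩ : P.domain) := fun x =>
    X.subι_injective _ _ _ (congrArg (fun m : XI ⟶ X => m.hom x) hj)
  have hi' : ∀ x : W,
      i.hom x = (⟨x, x.2.2⟩ : E) := fun x =>
    X.subι_injective _ _ _ (congrArg (fun m : XI ⟶ X => m.hom x) hi)
  have hiinj : Function.Injective i.hom := fun x y hxy => X.subι_injective _ _ _ (by
    rw [← hi, CoCom.comp_hom_apply, CoCom.comp_hom_apply, hxy])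
  have sq : CommSq (j ≫ g) i f (X.subι E hE hEpt ≫ v) := ⟨CoCom.hom_ext fun x => by
    rw [← Category.assoc, hi]
    exact (congrArg f.hom ((congrArg g.hom (hj' x)).trans (hg _))).trans (h.comp _)⟩
  have := hf i ⟨hiinj, ‹Module.Finite k E›⟩
  let Q₀ : X.carrier →ₗ.[k] C.carrier :=
    ⟨E, (sq.lift.hom : (X.sub E hE hEpt).carrier →ₗ[k] C.carrier)⟩
  have hagree : ∀ (x : P.domain) (y : Q₀.domain), (x : X.carrier) = y → P x = Q₀ y := by
    rintro ⟨x, hx⟩ ⟨y, hy⟩ (rfl : x = y)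
    have h1 := congrArg (fun m : XI ⟶ C => m.hom (⟨x, hx, hy⟩ : W)) sq.fac_left
    have h2 : sq.lift.hom (i.hom (⟨x, hx, hy⟩ : W)) =
      g.hom (j.hom (⟨x, hx, hy⟩ : W)) := h1
    exact ((congrArg g.hom (hj' _)).trans (hg _)).symm.trans
      (h2.symm.trans (congrArg sq.lift.hom (hi' _)))
  have hPle : P ≤ P.sup Q₀ hagree := P.left_le_sup Q₀ hagree
  have hQle : Q₀ ≤ P.sup Q₀ hagree := P.right_le_sup Q₀ hagree
  have hsum : ∀ z : (P.sup Q₀ hagree).domain, ∃ (x : P.domain) (y : Q₀.domain),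
      z = Submodule.inclusion hPle.1 x + Submodule.inclusion hQle.1 y := by
    rintro ⟨z, hz⟩
    obtain ⟨x, hx, y, hy, rfl⟩ := Submodule.mem_sup.1 hz
    exact ⟨⟨x, hx⟩, ⟨y, hy⟩, rfl⟩
  refine ⟨P.sup Q₀ hagree, ⟨fun z => ?_, fun z => ?_, hPle.1 h.pt_mem⟩, hPle, hQle.1⟩
  · obtain ⟨x, y, rfl⟩ := hsum z
    exact ((h.comul x).mono hPle).add ((comulCompatAt_of_hom sq.lift y).mono hQle)
  · obtain ⟨x, y, rfl⟩ := hsum z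
    have h1 : (P.sup Q₀ hagree) (Submodule.inclusion hPle.1 x) = P x := (hPle.2 rfl).symm
    have h2 : (P.sup Q₀ hagree) (Submodule.inclusion hQle.1 y) = Q₀ y := (hQle.2 rfl).symm
    have h3 : f.hom (Q₀ y) = v.hom y :=
      congrArg (fun m : X.sub E hE hEpt ⟶ D => m.hom y) sq.fac_right
    rw [LinearPMap.map_add, map_add, h1, h2, h3, h.comp]
    exact (map_add v.hom _ _).symm

/-- Apply Zorn's lemma to partial lifts extending `u` on the image of `i`. A maximal one is total,
since each element lies in a finite-dimensional subcoalgebra `Fₙ` over which it extends. -/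
theorem exists_lift_of_injective {f : C ⟶ D} (hf : (finiteInjections k).rlp f) {X₀ : CoCom k}
    (i : X₀ ⟶ X) (hi : Function.Injective i.hom) (u : X₀ ⟶ C) (v : X ⟶ D)
    (h : u ≫ f = i ≫ v) : ∃ w : X ⟶ C, i ≫ w = u ∧ w ≫ f = v := by
  let I := LinearEquiv.ofInjective (i.hom : X₀.carrier →ₗ[k] X.carrier) hi
  let P₀ : X.carrier →ₗ.[k] C.carrier :=
    ⟨LinearMap.range (i.hom : X₀.carrier →ₗ[k] X.carrier),
      (u.hom : X₀.carrier →ₗ[k] C.carrier) ∘ₗ I.symm.toLinearMap⟩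
  have hP₀ : ∀ x, P₀ (I x) = u.hom x := fun x => congrArg u.hom (I.symm_apply_apply x)
  have hlift₀ : IsPartialLift f v P₀ := by
    refine ⟨fun y => ?_, fun y => ?_, ⟨X₀.pt, CoCom.Hom.map_pt i⟩⟩
    · obtain ⟨x, rfl⟩ := I.surjective y
      refine ⟨TensorProduct.map I.toLinearMap I.toLinearMap (Coalgebra.comul (R := k) x), ?_, ?_⟩
      · rw [← LinearMap.comp_apply, ← TensorProduct.map_comp]
        exact CoalgHomClass.map_comp_comul_apply i.hom x
      · rw [← LinearMap.comp_apply, ← TensorProduct.map_comp, hP₀]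
        have : P₀.toFun ∘ₗ I.toLinearMap = (u.hom : X₀.carrier →ₗ[k] C.carrier) :=
          LinearMap.ext hP₀
        rw [this]
        exact CoalgHomClass.map_comp_comul_apply u.hom x
    · obtain ⟨x, rfl⟩ := I.surjective y
      rw [hP₀]
      exact congrArg (fun m : X₀ ⟶ D => m.hom x) h
  obtain ⟨P, hle, hmax⟩ := zorn_le_nonempty₀ {P | IsPartialLift f v P} (by
    intro c hc hchain Q hQ
    refine ⟨LinearPMap.sSup c hchain.directedOn, ?_, fun R hR => LinearPMap.le_sSup _ hR⟩
    have hmem : ∀ z : (LinearPMap.sSup c hchain.directedOn).domain, ∃ R, ∃ (hR : R ∈ c),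
        ∃ x : R.domain, z = Submodule.inclusion (LinearPMap.le_sSup _ hR).1 x := by
      rintro ⟨z, hz⟩
      obtain ⟨R, hR, hzR⟩ := (LinearPMap.mem_domain_sSup_iff ⟨Q, hQ⟩ hchain.directedOn).1 hz
      exact ⟨R, hR, ⟨z, hzR⟩, rfl⟩
    refine ⟨fun z => ?_, fun z => ?_, (LinearPMap.le_sSup _ hQ).1 (hc hQ).pt_mem⟩
    · obtain ⟨R, hR, x, rfl⟩ := hmem z
      exact ((hc hR).comul x).mono (LinearPMap.le_sSup hchain.directedOn hR)
    · obtain ⟨R, hR, x, rfl⟩ := hmem z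
      rw [← (LinearPMap.le_sSup hchain.directedOn hR).2 (x := x) rfl, (hc hR).comp]
      rfl) P₀ hlift₀
  have hP : IsPartialLift f v P := hmax.prop
  have htop : ∀ x, x ∈ P.domain := by
    intro x
    obtain ⟨n, hn⟩ := X.isConilpotent.exhaustive x
    have := X.finiteType
    have := finite_primFiltration (k := k) (e := X.pt) n
    obtain ⟨Q, hQ, hPQ, hEQ⟩ := hP.extend hf (primFiltration k X.pt n)
      (isSubcoalgebra_primFiltration X.isConilpotent.isGroupLike n)
      (self_mem_primFiltration X.isConilpotent.isGroupLike n)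
    exact (hmax.le_of_ge hQ hPQ).1 (hEQ hn)
  obtain ⟨g, hg⟩ := hP.exists_hom
  obtain ⟨s, hs⟩ := CoCom.exists_factor
    (X.subι P.domain (ComulCompatAt.isSubcoalgebra hP.comul) hP.pt_mem)
    (X.subι_injective _ _ _) (𝟙 X) (fun x => X.mem_range_subι _ _ _ (htop x))
  have hs' : ∀ x, s.hom x = (⟨x, htop x⟩ : P.domain) := fun x =>
    X.subι_injective _ _ _ (congrArg (fun m : X ⟶ X => m.hom x) hs)
  refine ⟨s ≫ g, CoCom.hom_ext fun x => ?_, CoCom.hom_ext fun x => ?_⟩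
  · rw [CoCom.comp_hom_apply, CoCom.comp_hom_apply, hs', hg, ← hP₀]
    exact (hle.2 rfl).symm
  · rw [CoCom.comp_hom_apply, CoCom.comp_hom_apply, hs', hg, hP.comp]

end PartialHom

end

section

variable {k : Type u} [Field k]

/-! ### Finite limits -/

namespace CoCom

theorem counit_pt (C : CoCom k) : Coalgebra.counit (R := k) C.pt = 1 :=
  C.isConilpotent.isGroupLike.counit_eq_one

theorem hom_ground_apply {C : CoCom k} (f : C ⟶ ground k) (x : C.carrier) :
    f.hom x = Coalgebra.counit (R := k) x :=
  CoalgHomClass.counit_comp_apply f.hom x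

/-- The ground field is terminal. -/
def groundIsTerminal : IsTerminal (ground k) :=
  IsTerminal.ofUniqueHom counit fun C m => hom_ext fun x => by
    rw [hom_ground_apply, hom_ground_apply]

/-- The base point as a morphism. -/
def point (C : CoCom k) : ground k ⟶ C :=
  CoCom.Hom.mk (C := ground k)
    { LinearMap.toSpanSingleton k C.carrier C.pt with
      counit_comp := LinearMap.ext_ring (by
        change Coalgebra.counit (R := k) ((1 : k) • C.pt) = 1
        rw [one_smul, counit_pt])
      map_comp_comul := LinearMap.ext_ring (by
        change TensorProduct.map (LinearMap.toSpanSingleton k C.carrier C.pt)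
          (LinearMap.toSpanSingleton k C.carrier C.pt) ((1 : k) ⊗ₜ[k] (1 : k)) =
            Coalgebra.comul (R := k) ((1 : k) • C.pt)
        rw [one_smul, C.isConilpotent.isGroupLike.comul_eq_tmul_self, TensorProduct.map_tmul,
          LinearMap.toSpanSingleton_apply, one_smul]) }

theorem point_injective (C : CoCom k) : Function.Injective C.point.hom := by
  have h : C.point ≫ C.counit = 𝟙 _ := groundIsTerminal.hom_ext _ _
  exact Function.LeftInverse.injective (g := C.counit.hom)
    fun x => congrArg (fun m : ground k ⟶ ground k => m.hom x) h

theorem ground_hom_ext {C : CoCom k} (f g : ground k ⟶ C) : f = g :=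
  hom_ext fun x => by
    have hx : x = (show k from x) • (ground k).pt := (mul_one (M := k) x).symm
    rw [hx, map_smul, map_smul, CoCom.Hom.map_pt, CoCom.Hom.map_pt]

variable [CharZero k] {V : Type u} [AddCommGroup V] [Module k V] [Module.Finite k V]

theorem symCo_hom_ext {C : CoCom k} {f g : C ⟶ symCo k V}
    (h : ∀ x, symCo.proj k V (f.hom x) = symCo.proj k V (g.hom x)) : f = g :=
  CoCom.Hom.ext (symLift_unique C.isConilpotent f.hom g.hom h)

theorem exists_hom_symCo (C : CoCom k) (φ : C.carrier →ₗ[k] V) (hφ : φ C.pt = 0) :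
    ∃ f : C ⟶ symCo k V, ∀ x, symCo.proj k V (f.hom x) = φ x := by
  obtain ⟨F, hF⟩ := exists_symLift C.isConilpotent φ hφ
  exact ⟨CoCom.Hom.mk (D := symCo k V) F, hF⟩

theorem proj_map_pt {C : CoCom k} (f : C ⟶ symCo k V) :
    symCo.proj k V (f.hom C.pt) = 0 := by
  rw [CoCom.Hom.map_pt]
  exact symProj_one k V

/-- A morphism to a symmetric coalgebra that is injective on primitives in degree one is
injective. -/
theorem injective_of_proj {C : CoCom k} {f : C ⟶ symCo k V}
    (h : ∀ x ∈ Prim C, symCo.proj k V (f.hom x) = 0 → x = 0) : Function.Injective f.hom :=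
  C.isConilpotent.injective f.hom fun x hx h0 => h x hx (by rw [h0, map_zero])

/-- Cofreeness lifts a linear retraction onto `Prim C` to a morphism that is injective on
primitives. -/
theorem exists_embedding (C : CoCom k) :
    ∃ (V : Type u) (_ : AddCommGroup V) (_ : Module k V) (_ : Module.Finite k V)
      (f : C ⟶ symCo k V), Function.Injective f.hom := by
  have := C.finiteType
  obtain ⟨ℓ, hℓ, hℓ0⟩ := exists_extend_prim (C := C) LinearMap.id
  obtain ⟨f, hf⟩ := C.exists_hom_symCo ℓ hℓ0
  refine ⟨Prim C, inferInstance, inferInstance, this, f, injective_of_proj fun x hx h0 => ?_⟩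
  rw [hf] at h0
  exact congrArg Subtype.val ((hℓ ⟨x, hx⟩).symm.trans h0)

/-- With `C` and `C'` embedded in `Sym(V)` and `Sym(V')`, the coalgebra `Sym(V × V')` plays the role
of the product. The pullback is its largest subcoalgebra on which both projections land in `C` and
`C'` and agree in `D`. -/
theorem exists_isPullback {C C' D : CoCom k} (f : C ⟶ D) (g : C' ⟶ D) :
    ∃ (L : CoCom k) (a : L ⟶ C) (b : L ⟶ C'), IsPullback a b f g := by
  obtain ⟨V, _, _, _, F, hF⟩ := exists_embedding C
  obtain ⟨V', _, _, _, F', hF'⟩ := exists_embedding C'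
  let S := symCo k (V × V')
  obtain ⟨p, hp⟩ := S.exists_hom_symCo (LinearMap.fst k V V' ∘ₗ symCo.proj k (V × V'))
    (by rw [LinearMap.comp_apply]; exact congrArg Prod.fst (symProj_one k (V × V')))
  obtain ⟨p', hp'⟩ := S.exists_hom_symCo (LinearMap.snd k V V' ∘ₗ symCo.proj k (V × V'))
    (by rw [LinearMap.comp_apply]; exact congrArg Prod.snd (symProj_one k (V × V')))
  obtain ⟨r, hr⟩ := (F.hom : C.carrier →ₗ[k] (symCo k V).carrier).exists_leftInverse_of_injective
    (LinearMap.ker_eq_bot.2 hF)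
  obtain ⟨r', hr'⟩ :=
    (F'.hom : C'.carrier →ₗ[k] (symCo k V').carrier).exists_leftInverse_of_injective
    (LinearMap.ker_eq_bot.2 hF')
  have hrF : ∀ x, r (F.hom x) = x := fun x => LinearMap.congr_fun hr x
  have hrF' : ∀ x, r' (F'.hom x) = x := fun x => LinearMap.congr_fun hr' x
  -- The linear left inverses `r`, `r'` let agreement in `D` be stated on all of `S`.
  let P : Submodule k S.carrier :=
    (LinearMap.range (F.hom : C.carrier →ₗ[k] (symCo k V).carrier)).comap
        (p.hom : S.carrier →ₗ[k] (symCo k V).carrier) ⊓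
      (LinearMap.range (F'.hom : C'.carrier →ₗ[k] (symCo k V').carrier)).comap
        (p'.hom : S.carrier →ₗ[k] (symCo k V').carrier) ⊓
      LinearMap.eqLocus
        ((f.hom : C.carrier →ₗ[k] D.carrier) ∘ₗ r ∘ₗ
          (p.hom : S.carrier →ₗ[k] (symCo k V).carrier))
        ((g.hom : C'.carrier →ₗ[k] D.carrier) ∘ₗ r' ∘ₗ
          (p'.hom : S.carrier →ₗ[k] (symCo k V').carrier))
  have hPmem : ∀ x, x ∈ P ↔ ((∃ y, F.hom y = p.hom x) ∧ (∃ y, F'.hom y = p'.hom x)) ∧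
      f.hom (r (p.hom x)) = g.hom (r' (p'.hom x)) := fun x => Iff.rfl
  let E := sSup {W : Submodule k S.carrier | IsSubcoalgebra k W ∧ W ≤ P}
  have hE : IsSubcoalgebra k E := isSubcoalgebra_sSup fun W hW => hW.1
  have hEP : E ≤ P := sSup_le fun W hW => hW.2
  have hle : ∀ W : Submodule k S.carrier, IsSubcoalgebra k W → W ≤ P → W ≤ E :=
    fun W h₁ h₂ => le_sSup ⟨h₁, h₂⟩
  have hpt : S.pt ∈ E := by
    refine hle _ (isSubcoalgebra_span_singleton S.isConilpotent.isGroupLike) ?_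
      (Submodule.mem_span_singleton_self _)
    rw [Submodule.span_singleton_le_iff_mem, hPmem]
    refine ⟨⟨⟨C.pt, ?_⟩, ⟨C'.pt, ?_⟩⟩, ?_⟩
    · rw [CoCom.Hom.map_pt, CoCom.Hom.map_pt]
    · rw [CoCom.Hom.map_pt, CoCom.Hom.map_pt]
    · rw [CoCom.Hom.map_pt, CoCom.Hom.map_pt, ← CoCom.Hom.map_pt F, ← CoCom.Hom.map_pt F', hrF,
        hrF', CoCom.Hom.map_pt, CoCom.Hom.map_pt]
  let j := S.subι E hE hpt
  have hj : Function.Injective j.hom := S.subι_injective E hE hpt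
  have hjP : ∀ x, j.hom x ∈ P := fun x => hEP (S.subι_mem E hE hpt x)
  obtain ⟨a, ha⟩ := exists_factor F hF (j ≫ p) fun x => ((hPmem _).1 (hjP x)).1.1
  obtain ⟨b, hb⟩ := exists_factor F' hF' (j ≫ p') fun x => ((hPmem _).1 (hjP x)).1.2
  have ha' : ∀ x, F.hom (a.hom x) = p.hom (j.hom x) := fun x =>
    congrArg (fun m : S.sub E hE hpt ⟶ symCo k V => m.hom x) ha
  have hb' : ∀ x, F'.hom (b.hom x) = p'.hom (j.hom x) := fun x =>
    congrArg (fun m : S.sub E hE hpt ⟶ symCo k V' => m.hom x) hb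
  have hw : a ≫ f = b ≫ g := hom_ext fun x => by
    have := ((hPmem _).1 (hjP x)).2
    rwa [← ha', ← hb', hrF, hrF'] at this
  have huniq : ∀ {T : CoCom k} (m m' : T ⟶ S.sub E hE hpt), m ≫ a = m' ≫ a → m ≫ b = m' ≫ b →
      m = m' := by
    intro T m m' h₁ h₂
    have key : m ≫ j = m' ≫ j := by
      refine symCo_hom_ext fun x => Prod.ext ?_ ?_
      · have h3 : ∀ m : T ⟶ S.sub E hE hpt,
            (symCo.proj k (V × V') (j.hom (m.hom x))).1 =
              symCo.proj k V (F.hom ((m ≫ a).hom x)) := fun m => by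
          rw [comp_hom_apply, ha', hp]; rfl
        rw [comp_hom_apply, comp_hom_apply, h3, h3, h₁]
      · have h3 : ∀ m : T ⟶ S.sub E hE hpt,
            (symCo.proj k (V × V') (j.hom (m.hom x))).2 =
              symCo.proj k V' (F'.hom ((m ≫ b).hom x)) := fun m => by
          rw [comp_hom_apply, hb', hp']; rfl
        rw [comp_hom_apply, comp_hom_apply, h3, h3, h₂]
    exact hom_ext fun x => hj (congrArg (fun n : T ⟶ S => n.hom x) key)
  have hex : ∀ {T : CoCom k} (s : T ⟶ C) (s' : T ⟶ C'), s ≫ f = s' ≫ g →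
      ∃ m : T ⟶ S.sub E hE hpt, m ≫ a = s ∧ m ≫ b = s' := by
    intro T s s' hss
    obtain ⟨h, hh⟩ := T.exists_hom_symCo
      (((symCo.proj k V) ∘ₗ ((s ≫ F).hom : T.carrier →ₗ[k] (symCo k V).carrier)).prod
        ((symCo.proj k V') ∘ₗ ((s' ≫ F').hom : T.carrier →ₗ[k] (symCo k V').carrier)))
      (Prod.ext (proj_map_pt (s ≫ F)) (proj_map_pt (s' ≫ F')))
    have h₁ : h ≫ p = s ≫ F := symCo_hom_ext fun x => by
      rw [comp_hom_apply, hp, LinearMap.comp_apply, hh]; rfl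
    have h₂ : h ≫ p' = s' ≫ F' := symCo_hom_ext fun x => by
      rw [comp_hom_apply, hp', LinearMap.comp_apply, hh]; rfl
    have h₁' : ∀ x, p.hom (h.hom x) = F.hom (s.hom x) := fun x =>
      congrArg (fun m : T ⟶ symCo k V => m.hom x) h₁
    have h₂' : ∀ x, p'.hom (h.hom x) = F'.hom (s'.hom x) := fun x =>
      congrArg (fun m : T ⟶ symCo k V' => m.hom x) h₂
    -- The image of a coalgebra morphism is a subcoalgebra, so maximality of `E` captures it.
    have hrange : LinearMap.range (h.hom : T.carrier →ₗ[k] S.carrier) ≤ E := by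
      refine hle _ (isSubcoalgebra_range h.hom) ?_
      rintro _ ⟨x, rfl⟩
      refine (hPmem _).2 ⟨⟨⟨s.hom x, (h₁' x).symm⟩, ⟨s'.hom x, (h₂' x).symm⟩⟩, ?_⟩
      have e₁ : r (p.hom (h.hom x)) = s.hom x := by rw [h₁', hrF]
      have e₂ : r' (p'.hom (h.hom x)) = s'.hom x := by rw [h₂', hrF']
      refine (congrArg f.hom e₁).trans (Eq.trans ?_ (congrArg g.hom e₂).symm)
      exact congrArg (fun m : T ⟶ D => m.hom x) hss
    obtain ⟨m, hm⟩ := exists_factor j hj h fun x =>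
      S.mem_range_subι E hE hpt (hrange ⟨x, rfl⟩)
    refine ⟨m, hom_ext fun x => hF ?_, hom_ext fun x => hF' ?_⟩
    · rw [← h₁', ← hm, comp_hom_apply, ha', comp_hom_apply]
    · rw [← h₂', ← hm, comp_hom_apply, hb', comp_hom_apply]
  refine ⟨S.sub E hE hpt, a, b, ⟨⟨hw⟩, ⟨PullbackCone.IsLimit.mk hw
    (fun s => (hex s.fst s.snd s.condition).choose)
    (fun s => (hex s.fst s.snd s.condition).choose_spec.1)
    (fun s => (hex s.fst s.snd s.condition).choose_spec.2)
    fun s m h₁ h₂ => huniq _ _ ?_ ?_⟩⟩⟩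
  · rw [h₁, (hex s.fst s.snd s.condition).choose_spec.1]
  · rw [h₂, (hex s.fst s.snd s.condition).choose_spec.2]

theorem hasFiniteLimits : HasFiniteLimits (CoCom k) := by
  have : HasTerminal (CoCom k) := groundIsTerminal.hasTerminal
  have : HasPullbacks (CoCom k) := by
    refine @hasPullbacks_of_hasLimit_cospan _ _ fun {X Y Z f g} => ?_
    obtain ⟨L, a, b, h⟩ := exists_isPullback f g
    exact h.hasPullback
  exact hasFiniteLimits_of_hasTerminal_and_pullbacks

end CoCom

end

section

variable {k : Type u} [Field k]

/-! ### Properties of formal submersions -/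

/-- Lift the identity of `D` relative to the base point. -/
theorem IsFormalSubmersion.exists_section {C D : CoCom k} {f : C ⟶ D}
    (hf : IsFormalSubmersion f) : ∃ s : D ⟶ C, s ≫ f = 𝟙 D := by
  obtain ⟨s, -, hs⟩ := exists_lift_of_injective hf.rlp D.point D.point_injective C.point (𝟙 D)
    (CoCom.ground_hom_ext _ _)
  exact ⟨s, hs⟩

theorem IsFormalSubmersion.prim_surjective {C D : CoCom k} {f : C ⟶ D}
    (hf : IsFormalSubmersion f) : Function.Surjective (Prim.map f) := by
  obtain ⟨s, hs⟩ := hf.exists_section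
  intro x
  refine ⟨Prim.map s x, Subtype.ext ?_⟩
  exact congrArg (fun m : D ⟶ D => m.hom x) hs

theorem isEffectiveEpimorphism_of_section {𝒟 : Type*} [Category 𝒟] [HasPullbacks 𝒟] {X Y : 𝒟}
    {f : X ⟶ Y} {s : Y ⟶ X} (hs : s ≫ f = 𝟙 Y) : IsEffectiveEpimorphism f := by
  have h : IsKernelPair f (pullback.fst f f) (pullback.snd f f) := IsPullback.of_hasPullback f f
  refine ⟨_, _, _, h, ⟨Cofork.IsColimit.mk _ (fun c => s ≫ c.π) (fun c => ?_) fun c m hm => ?_⟩⟩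
  -- The pair `(f ≫ s, 𝟙)` factors through the kernel pair, so any cofork `c` satisfies `f ≫ s ≫ c.π
  -- = c.π`.
  · have hw : (f ≫ s) ≫ f = 𝟙 X ≫ f := by rw [Category.assoc, hs, Category.comp_id,
      Category.id_comp]
    calc f ≫ s ≫ c.π = (h.lift (f ≫ s) (𝟙 X) hw ≫ pullback.fst f f) ≫ c.π := by
          rw [h.lift_fst, Category.assoc]
      _ = (h.lift (f ≫ s) (𝟙 X) hw ≫ pullback.snd f f) ≫ c.π := by
          rw [Category.assoc, c.condition, Category.assoc]
      _ = c.π := by rw [h.lift_snd, Category.id_comp]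
  · rw [← hm, Cofork.π_ofπ, ← Category.assoc, hs]
    exact (Category.id_comp m).symm

/-- The map `u : T₀ → Y` lifts through `f`, as the base point of `T₀` is an injection. Solve the
problem for `f ≫ g` and push the solution forward by `f`. -/
theorem rlp_finiteInjections_cancel {X Y Z : CoCom k} (f : X ⟶ Y) (g : Y ⟶ Z)
    (hf : (finiteInjections k).rlp f) (hfg : (finiteInjections k).rlp (f ≫ g)) :
    (finiteInjections k).rlp g := by
  rintro T₀ T i ⟨hi, hT⟩
  refine ⟨fun {u v} sq => ?_⟩
  obtain ⟨u', -, hu'⟩ := exists_lift_of_injective hf T₀.point T₀.point_injective X.point u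
    (CoCom.ground_hom_ext _ _)
  obtain ⟨w, hw₁, hw₂⟩ := exists_lift_of_injective hfg i hi u' v (by
    rw [← Category.assoc, hu', sq.w])
  exact ⟨⟨⟨w ≫ f, by rw [← Category.assoc, hw₁, hu'], by rw [Category.assoc, hw₂]⟩⟩⟩

theorem isDescentCategory [CharZero k] :
    IsDescentCategory (CoCom k) (formalSubmersions k) where
  isMultiplicative := by rw [formalSubmersions_eq_rlp]; infer_instance
  hasFiniteLimits := CoCom.hasFiniteLimits
  terminal T _ := by
    rw [formalSubmersions_eq_rlp]
    exact MorphismProperty.id_mem _ T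
  baseChange := by rw [formalSubmersions_eq_rlp]; infer_instance
  cancel f g := by
    rw [formalSubmersions_eq_rlp]
    exact rlp_finiteInjections_cancel f g
  effective f hf := by
    have := CoCom.hasFiniteLimits (k := k)
    obtain ⟨s, hs⟩ := IsFormalSubmersion.exists_section hf
    exact isEffectiveEpimorphism_of_section hs

/-! ### Formal manifolds -/

theorem IsFormalManifold.of_iso {C D : CoCom k} (e : C ≅ D) (h : IsFormalManifold D) :
    IsFormalManifold C := by
  have h1 : (finiteInjections k).rlp (e.hom ≫ D.counit) :=
    MorphismProperty.comp_mem _ _ _ (MorphismProperty.rlp_of_isIso _ _)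
      (IsFormalSubmersion.rlp h)
  rw [CoCom.groundIsTerminal.hom_ext (e.hom ≫ D.counit) C.counit] at h1
  exact isFormalSubmersion_of_rlp h1

variable [CharZero k] {V : Type u} [AddCommGroup V] [Module k V] [Module.Finite k V]

/-- Morphisms to `Sym(V)` are linear maps to `V` vanishing at the base point, and these extend along
a linear left inverse of `i`. -/
theorem isFormalManifold_symCo : IsFormalManifold (symCo k V) := by
  refine isFormalSubmersion_of_rlp ?_
  rintro X₀ X i ⟨hi, hX⟩
  refine ⟨fun {u v} sq => ?_⟩
  obtain ⟨r, hr⟩ := (i.hom : X₀.carrier →ₗ[k] X.carrier).exists_leftInverse_of_injective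
    (LinearMap.ker_eq_bot.2 hi)
  have hri : ∀ x, r (i.hom x) = x := fun x => LinearMap.congr_fun hr x
  obtain ⟨w, hw⟩ := X.exists_hom_symCo
    (symCo.proj k V ∘ₗ (u.hom : X₀.carrier →ₗ[k] (symCo k V).carrier) ∘ₗ r) (by
      rw [← CoCom.Hom.map_pt i, LinearMap.comp_apply, LinearMap.comp_apply, hri]
      exact CoCom.proj_map_pt u)
  refine ⟨⟨⟨w, CoCom.symCo_hom_ext fun x => ?_, CoCom.groundIsTerminal.hom_ext _ _⟩⟩⟩
  rw [CoCom.comp_hom_apply, hw, LinearMap.comp_apply, LinearMap.comp_apply, hri]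
  rfl

/-- Linear coordinates on a formal manifold identify it with a symmetric coalgebra. -/
theorem IsFormalManifold.exists_isIso {C : CoCom k} (hC : IsFormalManifold C)
    (a : C.carrier →ₗ[k] V) (ha : a C.pt = 0)
    (hinj : ∀ x : Prim C, a x = 0 → x = 0) (hsurj : ∀ v, ∃ x : Prim C, a x = v) :
    ∃ F : C ⟶ symCo k V, IsIso F ∧ ∀ x, symCo.proj k V (F.hom x) = a x := by
  obtain ⟨F, hF⟩ := C.exists_hom_symCo a ha
  have hFinj : Function.Injective F.hom := CoCom.injective_of_proj fun x hx h0 => by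
    rw [hF] at h0
    exact congrArg Subtype.val (hinj ⟨x, hx⟩ h0)
  obtain ⟨r, hr, -⟩ := exists_lift_of_injective (IsFormalSubmersion.rlp hC) F hFinj (𝟙 C)
    (symCo k V).counit (CoCom.groundIsTerminal.hom_ext _ _)
  have hr' : ∀ x, r.hom (F.hom x) = x := fun x => congrArg (fun m : C ⟶ C => m.hom x) hr
  -- The primitives of `Sym(V)` are `V`, and `F` reaches all of them because `a` is onto. There the
  -- retraction inverts `F`, so it is injective, hence a two-sided inverse.
  have hrinj : Function.Injective r.hom :=
    (symCo k V).isConilpotent.injective r.hom fun y hy h0 => by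
      obtain ⟨v, hv⟩ := primitives_sym_le k V hy
      obtain ⟨x, hx⟩ := hsurj v
      obtain ⟨v', hv'⟩ := primitives_sym_le k V (Prim.map F x).2
      have h1 : v' = v := by
        rw [← symProj_ι k V v', hv', ← hx]
        exact hF x
      have h2 : y = F.hom x := by
        rw [← hv, ← h1, hv']; rfl
      rw [h2, hr'] at h0
      rw [h2, h0, map_zero]
  refine ⟨F, ⟨r, hr, CoCom.hom_ext fun y => hrinj ?_⟩, hF⟩
  exact hr' (r.hom y)

theorem isFormalManifold_iff (C : CoCom k) : IsFormalManifold C ↔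
    ∃ (V : Type u) (_ : AddCommGroup V) (_ : Module k V) (_ : Module.Finite k V),
      Nonempty (C ≅ symCo k V) := by
  constructor
  · intro hC
    have := C.finiteType
    obtain ⟨a, ha, ha0⟩ := exists_extend_prim (C := C) LinearMap.id
    obtain ⟨F, hF, -⟩ := hC.exists_isIso a ha0 (fun x hx => (ha x).symm.trans hx)
      fun v => ⟨v, ha v⟩
    exact ⟨Prim C, inferInstance, inferInstance, this, ⟨asIso F⟩⟩
  · rintro ⟨V, _, _, _, ⟨e⟩⟩
    exact isFormalManifold_symCo.of_iso e

/-- Coordinates on `C` are a complement coordinate in `K = ker Prim(f)` together with the pullback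
along `f` of coordinates on `D`. In them `f` is the projection `K × Prim D → Prim D`, so a lift
takes its second component from `v` and its first from a linear extension of that of `u`. -/
theorem isFormalSubmersion_of_prim_surjective {C D : CoCom k} (f : C ⟶ D)
    (hC : IsFormalManifold C) (hD : IsFormalManifold D)
    (hf : Function.Surjective (Prim.map f)) : IsFormalSubmersion f := by
  have := C.finiteType
  have := D.finiteType
  let K := LinearMap.ker (Prim.map f)
  obtain ⟨c, hc⟩ := exists_projection K
  obtain ⟨c', hc', hc0⟩ := exists_extend_prim c
  obtain ⟨b, hb, hb0⟩ := exists_extend_prim (C := D) LinearMap.id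
  let a : C.carrier →ₗ[k] K × Prim D := c'.prod (b ∘ₗ (f.hom : C.carrier →ₗ[k] D.carrier))
  have ha : ∀ x : Prim C, a x = (c x, Prim.map f x) := fun x =>
    Prod.ext (hc' x) (hb (Prim.map f x))
  have hcK : ∀ x : K, c x = x := fun x => LinearMap.congr_fun hc x
  obtain ⟨F, hF, hFa⟩ := hC.exists_isIso a
    (Prod.ext hc0 (by
      change b (f.hom C.pt) = 0
      rw [CoCom.Hom.map_pt, hb0]))
    (fun x hx => by
      rw [ha] at hx
      have h2 := hcK ⟨x, congrArg Prod.snd hx⟩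
      have h1 : c x = 0 := congrArg Prod.fst hx
      exact congrArg Subtype.val (h2.symm.trans h1))
    (fun ⟨κ, y⟩ => by
      obtain ⟨x, rfl⟩ := hf y
      -- Correcting by an element of `K` adjusts the first coordinate to `κ` and leaves `Prim(f)`
      -- unchanged.
      refine ⟨x + ((κ - c x : K) : Prim C), ?_⟩
      rw [ha, map_add, map_add, hcK, LinearMap.mem_ker.1 (κ - c x).2, add_zero,
        add_sub_cancel])
  obtain ⟨G, hG, hGb⟩ := hD.exists_isIso b hb0 (fun x hx => (hb x).symm.trans hx)
    fun v => ⟨v, hb v⟩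
  refine isFormalSubmersion_of_rlp ?_
  rintro X₀ X i ⟨hi, hX⟩
  refine ⟨fun {u v} sq => ?_⟩
  obtain ⟨r, hr⟩ := (i.hom : X₀.carrier →ₗ[k] X.carrier).exists_leftInverse_of_injective
    (LinearMap.ker_eq_bot.2 hi)
  have hri : ∀ x, r (i.hom x) = x := fun x => LinearMap.congr_fun hr x
  obtain ⟨h, hh⟩ := X.exists_hom_symCo
    ((c' ∘ₗ (u.hom : X₀.carrier →ₗ[k] C.carrier) ∘ₗ r).prod
      (b ∘ₗ (v.hom : X.carrier →ₗ[k] D.carrier)))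
    (Prod.ext (by
      change c' (u.hom (r X.pt)) = 0
      rw [← CoCom.Hom.map_pt i, hri, CoCom.Hom.map_pt, hc0]) (by
      change b (v.hom X.pt) = 0
      rw [CoCom.Hom.map_pt, hb0]))
  have hw : ∀ x, F.hom ((h ≫ inv F).hom x) = h.hom x := fun x =>
    congrArg (fun m : X ⟶ symCo k (K × Prim D) => m.hom x)
      (show (h ≫ inv F) ≫ F = h by simp)
  refine ⟨⟨⟨h ≫ inv F, ?_, ?_⟩⟩⟩
  · rw [← Category.assoc, IsIso.comp_inv_eq]
    refine CoCom.symCo_hom_ext fun x => ?_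
    rw [CoCom.comp_hom_apply, CoCom.comp_hom_apply, hh, hFa]
    refine Prod.ext ?_ ?_
    · change c' (u.hom (r (i.hom x))) = c' (u.hom x)
      rw [hri]
    · exact congrArg (fun m : X₀ ⟶ D => b (m.hom x)) sq.w.symm
  · rw [← cancel_mono G]
    refine CoCom.symCo_hom_ext fun x => ?_
    rw [CoCom.comp_hom_apply, CoCom.comp_hom_apply, hGb, CoCom.comp_hom_apply v G, hGb]
    have h1 := hFa ((h ≫ inv F).hom x)
    rw [hw, hh] at h1
    exact (congrArg Prod.snd h1).symm

end

end FormalCoalg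

end

theorem mainTheorem9 (k : Type u) [Field k] [CharZero k] :
    -- the coalgebras with the formal submersions form a descent category
    FormalCoalg.IsDescentCategory (FormalCoalg.CoCom k) (FormalCoalg.formalSubmersions k) ∧
    -- formal submersions are surjective on primitives
    (∀ (C D : FormalCoalg.CoCom k) (f : C ⟶ D), FormalCoalg.IsFormalSubmersion f →
      Function.Surjective (FormalCoalg.Prim.map f)) ∧
    -- the formal manifolds are exactly the symmetric coalgebras, and these are cofree
    ((∀ C : FormalCoalg.CoCom k, FormalCoalg.IsFormalManifold C ↔
        ∃ (V : Type u) (_ : AddCommGroup V) (_ : Module k V) (_ : Module.Finite k V),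
          Nonempty (C ≅ FormalCoalg.symCo k V)) ∧
      (∀ (V : Type u) [AddCommGroup V] [Module k V] [Module.Finite k V],
        FormalCoalg.IsCofree (FormalCoalg.symCo k V) (FormalCoalg.symCo.proj k V))) ∧
    -- between formal manifolds, surjectivity on primitives implies formal submersion
    (∀ (C D : FormalCoalg.CoCom k) (f : C ⟶ D), FormalCoalg.IsFormalManifold C →
      FormalCoalg.IsFormalManifold D → Function.Surjective (FormalCoalg.Prim.map f) →
      FormalCoalg.IsFormalSubmersion f) := by
  exact ⟨FormalCoalg.isDescentCategory, fun _ _ _ hf => hf.prim_surjective,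
    ⟨FormalCoalg.isFormalManifold_iff, fun _ => FormalCoalg.isCofree_symCo⟩,
    fun _ _ => FormalCoalg.isFormalSubmersion_of_prim_surjective⟩
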